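/- Let $\mathbb F$ be a field and let $\Lambda$ be a finite-dimensional hereditary $\mathbb F$-algebra, i.e. every submodule of a projective left $\Lambda$-module is projective. Write $(-)^*=\operatorname{Hom}_{\mathbb F}(-,\mathbb F)$. Let $\tau^-$ be the inverse Auslander–Reiten translation, regarded as an endofunctor of left $\Lambda$-modules, $\tau^-M=\operatorname{Ext}^1_{\Lambda^{\mathrm{op}}}(M^*,\Lambda)$ (the transpose over a hereditary algebra being $\operatorname{Ext}^1(-,\Lambda)$); the endofunctor $\tau^-$ of right $\Lambda$-modules is defined in the same way, with $\Lambda^{\mathrm{op}}$ in place of $\Lambda$. Write $\tau^{-r}$ for the $r$-th iterate of $\tau^-$. The left and the right preprojective algebra of $\Lambda$ are $$\Pi_{\ell}=\bigoplus_{r\ge 0}\operatorname{Hom}_\Lambda(\Lambda,\tau^{-r}\Lambda),\qquad \Pi_{\mathrm r}=\bigoplus_{r\ge 0}\operatorname{Hom}_{\Lambda^{\mathrm{op}}}(\Lambda,\tau^{-r}\Lambda),$$ each graded by $r$, where the product of $g:\Lambda\to\tau^{-s}\Lambda$ and $f:\Lambda\to\tau^{-r}\Lambda$ is $gf=\tau^{-r}g\circ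 f:\Lambda\to\tau^{-r-s}\Lambda$. Write $L_r$ for $\tau^{-r}\Lambda$ formed with left modules, and $R_r$ for $\tau^{-r}\Lambda$ formed with right modules. Both are $\Lambda$-$\Lambda$-bimodules: the second action comes, by functoriality, from the right (respectively left) multiplications on $\Lambda$. Then $L_1$ and $R_1$ are isomorphic as bimodules. Moreover, for every bimodule isomorphism $\theta_1:L_1\to R_1$ there is exactly one way to choose bimodule isomorphisms $\theta_r:L_r\to R_r$ for all $r\geq 0$, with $\theta_0=\operatorname{id}_\Lambda$ and with the given $\theta_1$, such that, identifying $L_r$ with $R_r$ along $\theta_r$ and writing $\tau^{-r}\Lambda$ for both, there is a grading-preserving $\mathbb F$-algebra anti-isomorphism $$R:\Pi_{\ell}\to\Pi_{\mathrm r},\qquad f\mapsto \ell_{f(1)}\quad\text{for } f:\Lambda\to\tau^{-r}\Lambda,$$ where $\ell_y:\Lambda\to\tau^{-r}\Lambda$ is the left multiplication $a\mapsto ya$, and such that the following holds. For all idempotents $e_i,e_j\in\Lambda$ put $P_i=\Lambda e_i$ and ${}_iP=e_i\Lambda\cong\operatorname{Hom}_\Lambda(P_i,\Lambda)$, and likewise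 for $j$; regard $\operatorname{Hom}_\Lambda(P_i,\tau^{-r}P_j)$ as a subspace of $\operatorname{Hom}_\Lambda(\Lambda,\tau^{-r}\Lambda)$, and $\operatorname{Hom}_{\Lambda^{\mathrm{op}}}({}_jP,\tau^{-r}({}_iP))$ as a subspace of $\operatorname{Hom}_{\Lambda^{\mathrm{op}}}(\Lambda,\tau^{-r}\Lambda)$, via the inclusions of, and the projections $x\mapsto xe$ (respectively $x\mapsto ex$) onto, these direct summands of $\Lambda$. Then, for every $r\ge 0$, $R$ maps $\operatorname{Hom}_\Lambda(P_i,\tau^{-r}P_j)$ isomorphically onto $\operatorname{Hom}_{\Lambda^{\mathrm{op}}}({}_jP,\tau^{-r}({}_iP))$. -/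

import Mathlib

open CategoryTheory CategoryTheory.Abelian MulOpposite
open scoped ModuleCat DirectSum

universe u

/-- A ring is (left) hereditary if every submodule of a projective (left) module is projective. -/
def IsHereditary (A : Type u) [Ring A] : Prop :=
  ∀ (M : Type u) [AddCommGroup M] [Module A M] [Module.Projective A M] (N : Submodule A M),
    Module.Projective A N

namespace Preproj

noncomputable section

section Translate

variable (F : Type u) [Field F] (A : Type u) [Ring A] [Algebra F A]

/-- The `F`-linear dual `M* = Hom_F(M, F)` of a left `A`-module, as a right `A`-module
(i.e. a left `Aᵐᵒᵖ`-module): `(φ · a)(m) = φ (a m)`. -/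
abbrev dualModule (M : ModuleCat.{u} A) : Module Aᵐᵒᵖ (Module.Dual F M) where
  smul a φ := φ.comp (Algebra.lsmul F F M a.unop)
  one_smul φ := LinearMap.ext fun m => congrArg φ (one_smul A m)
  mul_smul a b φ := LinearMap.ext fun m => congrArg φ (mul_smul b.unop a.unop m)
  smul_zero _ := rfl
  smul_add _ _ _ := rfl
  add_smul a b φ := LinearMap.ext fun m =>
    (congrArg φ (add_smul a.unop b.unop m)).trans (map_add φ _ _)
  zero_smul φ := LinearMap.ext fun m => (congrArg φ (zero_smul A m)).trans (map_zero φ)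

/-- The right `A`-module `M*`, as an object of the category of right `A`-modules. -/
def dualObj (M : ModuleCat.{u} A) : ModuleCat.{u} Aᵐᵒᵖ :=
  letI := dualModule F A M
  ModuleCat.of Aᵐᵒᵖ (Module.Dual F M)

/-- The transpose `f* : N* → M*`, `φ ↦ φ ∘ f`, of a map `f : M → N`. -/
def dualMap {M N : ModuleCat.{u} A} (f : M ⟶ N) : dualObj F A N ⟶ dualObj F A M :=
  letI := dualModule F A M
  letI := dualModule F A N
  ModuleCat.ofHom
    { toFun := fun φ : Module.Dual F N => φ.comp (f.hom.restrictScalars F)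
      map_add' := fun _ _ => rfl
      map_smul' := fun a φ => LinearMap.ext fun m => congrArg φ (map_smul f.hom a.unop m).symm }

theorem dualMap_id (M : ModuleCat.{u} A) : dualMap F A (𝟙 M) = 𝟙 _ := rfl

theorem dualMap_comp {L M N : ModuleCat.{u} A} (f : L ⟶ M) (g : M ⟶ N) :
    dualMap F A (f ≫ g) = dualMap F A g ≫ dualMap F A f := rfl

theorem dualMap_add {M N : ModuleCat.{u} A} (f g : M ⟶ N) :
    dualMap F A (f + g) = dualMap F A f + dualMap F A g := by
  refine ModuleCat.hom_ext (LinearMap.ext fun φ => ?_)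
  exact LinearMap.ext fun m => map_add (show Module.Dual F N from φ) (f m) (g m)

theorem dualMap_smul {M N : ModuleCat.{u} A} (c : F) (f : M ⟶ N) :
    dualMap F A (c • f) = c • dualMap F A f := by
  refine ModuleCat.hom_ext (LinearMap.ext fun φ => ?_)
  exact LinearMap.ext fun m => congrArg (show Module.Dual F N from φ)
    (map_smul f.hom (algebraMap F A c) m).symm

/-- The regular right `A`-module. -/
def rightRegular : ModuleCat.{u} Aᵐᵒᵖ := ModuleCat.of Aᵐᵒᵖ A

/-- Left multiplication by `a`, an endomorphism of the regular right module. -/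
def lmul (a : A) : rightRegular A ⟶ rightRegular A :=
  ModuleCat.ofHom
    { toFun := fun x : A => a * x
      map_add' := mul_add a
      map_smul' := fun b x => (mul_assoc a x b.unop).symm }

theorem lmul_one : lmul A 1 = 𝟙 _ :=
  ModuleCat.hom_ext (LinearMap.ext fun x => one_mul (show A from x))

theorem lmul_mul (a b : A) : lmul A (a * b) = lmul A b ≫ lmul A a :=
  ModuleCat.hom_ext (LinearMap.ext fun x => mul_assoc a b (show A from x))

theorem lmul_add (a b : A) : lmul A (a + b) = lmul A a + lmul A b :=
  ModuleCat.hom_ext (LinearMap.ext fun x => add_mul a b (show A from x))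

theorem lmul_algebraMap (c : F) : lmul A (algebraMap F A c) = c • 𝟙 (rightRegular A) :=
  ModuleCat.hom_ext (LinearMap.ext fun x => Algebra.commutes c (show A from x))

/-- The abelian group `Ext¹(M*, A)`, the extension group in the category of right `A`-modules. -/
abbrev TauGroup (M : ModuleCat.{u} A) : Type u := Ext (dualObj F A M) (rightRegular A) 1

/-- The left `A`-module structure on `Ext¹(M*, A)`, induced by the left multiplications on `A`. -/
abbrev tauModule (M : ModuleCat.{u} A) : Module A (TauGroup F A M) where
  smul a x := x.comp (Ext.mk₀ (lmul A a)) (add_zero 1)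
  one_smul x := by
    change x.comp (Ext.mk₀ (lmul A 1)) (add_zero 1) = x
    rw [lmul_one, Ext.comp_mk₀_id]
  mul_smul a b x := by
    change x.comp (Ext.mk₀ (lmul A (a * b))) (add_zero 1) =
      (x.comp (Ext.mk₀ (lmul A b)) (add_zero 1)).comp (Ext.mk₀ (lmul A a)) (add_zero 1)
    rw [lmul_mul, Ext.comp_assoc_of_third_deg_zero, Ext.mk₀_comp_mk₀]
  smul_zero a := by
    change (0 : TauGroup F A M).comp (Ext.mk₀ (lmul A a)) (add_zero 1) = 0
    rw [Ext.zero_comp]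
  smul_add a x y := Ext.add_comp _ _ _ _
  add_smul a b x := by
    change x.comp (Ext.mk₀ (lmul A (a + b))) (add_zero 1) =
      x.comp (Ext.mk₀ (lmul A a)) (add_zero 1) + x.comp (Ext.mk₀ (lmul A b)) (add_zero 1)
    rw [lmul_add, Ext.mk₀_add, Ext.comp_add]
  zero_smul x := by
    change x.comp (Ext.mk₀ (lmul A 0)) (add_zero 1) = 0
    have h : lmul A 0 = 0 :=
      ModuleCat.hom_ext (LinearMap.ext fun x => zero_mul (show A from x))
    rw [h, Ext.mk₀_zero, Ext.comp_zero]

/-- The inverse Auslander-Reiten translation `τ⁻` of a hereditary algebra `A`, as an endofunctor: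
`τ⁻ = Tr D`, where `D = (-)*` and the transpose `Tr` of a right module `N` over a hereditary
algebra is the left module `Ext¹(N, A)`. Thus `τ⁻ M = Ext¹(M*, A)`. -/
def tauMinus : ModuleCat.{u} A ⥤ ModuleCat.{u} A where
  obj M :=
    letI := tauModule F A M
    ModuleCat.of A (TauGroup F A M)
  map {M N} f :=
    letI := tauModule F A M
    letI := tauModule F A N
    ModuleCat.ofHom
      { toFun := fun x : TauGroup F A M => (Ext.mk₀ (dualMap F A f)).comp x (zero_add 1)
        map_add' := fun _ _ => Ext.comp_add _ _ _ _
        map_smul' := fun a x =>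
          (Ext.comp_assoc_of_third_deg_zero (Ext.mk₀ (dualMap F A f)) x
            (Ext.mk₀ (lmul A a)) (zero_add 1)).symm }
  map_id M :=
    letI := tauModule F A M
    ModuleCat.hom_ext (LinearMap.ext fun x => Ext.mk₀_id_comp (show TauGroup F A M from x))
  map_comp {L M N} f g :=
    letI := tauModule F A L
    letI := tauModule F A M
    letI := tauModule F A N
    ModuleCat.hom_ext (LinearMap.ext fun x =>
      (Ext.mk₀_comp_mk₀_assoc (dualMap F A g) (dualMap F A f) (show TauGroup F A L from x)).symm)

instance : (tauMinus F A).Additive where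
  map_add {M N f g} := ModuleCat.hom_ext (LinearMap.ext fun x => by
    change (Ext.mk₀ (dualMap F A (f + g))).comp (show TauGroup F A M from x) (zero_add 1) =
      (Ext.mk₀ (dualMap F A f)).comp (show TauGroup F A M from x) (zero_add 1) +
      (Ext.mk₀ (dualMap F A g)).comp (show TauGroup F A M from x) (zero_add 1)
    rw [dualMap_add, Ext.mk₀_add, Ext.add_comp])

instance : (tauMinus F A).Linear F where
  map_smul {M N} f c := ModuleCat.hom_ext (LinearMap.ext fun x => by
    change (Ext.mk₀ (dualMap F A (c • f))).comp (show TauGroup F A M from x) (zero_add 1) =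
      ((Ext.mk₀ (dualMap F A f)).comp (show TauGroup F A M from x) (zero_add 1)).comp
        (Ext.mk₀ (lmul A (algebraMap F A c))) (add_zero 1)
    rw [dualMap_smul, lmul_algebraMap, ← Ext.smul_eq_comp_mk₀, Ext.mk₀_smul, Ext.smul_comp])

/-- The iterates `τ^{-r}`. -/
def tauPow : ℕ → (ModuleCat.{u} A ⥤ ModuleCat.{u} A)
  | 0 => 𝟭 _
  | r + 1 => tauPow r ⋙ tauMinus F A

instance tauPow_additive (r : ℕ) : (tauPow F A r).Additive := by
  induction r with
  | zero => exact inferInstanceAs (𝟭 (ModuleCat.{u} A)).Additive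
  | succ r ih => exact inferInstanceAs (tauPow F A r ⋙ tauMinus F A).Additive

instance tauPow_linear (r : ℕ) : (tauPow F A r).Linear F := by
  induction r with
  | zero => exact inferInstanceAs ((𝟭 (ModuleCat.{u} A)).Linear F)
  | succ r ih => exact inferInstanceAs ((tauPow F A r ⋙ tauMinus F A).Linear F)

theorem tauPow_add (s r : ℕ) : tauPow F A s ⋙ tauPow F A r = tauPow F A (s + r) := by
  induction r with
  | zero => rfl
  | succ r ih =>
    change (tauPow F A s ⋙ tauPow F A r) ⋙ tauMinus F A = tauPow F A (s + r) ⋙ tauMinus F A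
    rw [ih]

/-- `τ^{-r} τ^{-s} M = τ^{-(s+r)} M`. -/
theorem tauPow_obj (s r : ℕ) (M : ModuleCat.{u} A) :
    (tauPow F A r).obj ((tauPow F A s).obj M) = (tauPow F A (s + r)).obj M :=
  congrArg (fun G : ModuleCat.{u} A ⥤ ModuleCat.{u} A => G.obj M) (tauPow_add F A s r)

/-- The left module `τ^{-r} A`, where `A` is the regular left module. -/
abbrev T (r : ℕ) : ModuleCat.{u} A := (tauPow F A r).obj (ModuleCat.of A A)

/-- Right multiplication by `a`, an endomorphism of the regular left module. -/
def rmul (a : A) : ModuleCat.of A A ⟶ ModuleCat.of A A :=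
  ModuleCat.ofHom (LinearMap.toSpanSingleton A A a)

/-- The second action of `a : A` on `τ^{-r} A`, from the right multiplication by `a` on the
regular left module `A` by functoriality. It makes `τ^{-r} A` a bimodule. -/
def rightAct (r : ℕ) (a : A) (x : T F A r) : T F A r :=
  (tauPow F A r).map (rmul A a) x

/-- The map `A → τ^{-r} A`, `a ↦ a y`, for `y ∈ τ^{-r} A`. When `A = Λᵐᵒᵖ` so that `τ^{-r} A` is a
right `Λ`-module, this is `a ↦ y a`, i.e. left multiplication by `y`. -/
def mulMap (r : ℕ) (y : T F A r) : ModuleCat.of A A ⟶ T F A r :=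
  ModuleCat.ofHom (LinearMap.toSpanSingleton A (T F A r) y)

/-- The degree `r` part `Hom_A(A, τ^{-r} A)` of the preprojective algebra. -/
abbrev Piece (r : ℕ) : Type u := ModuleCat.of A A ⟶ T F A r

/-- The product `g f = τ^{-r} g ∘ f` of `g : A → τ^{-s} A` and `f : A → τ^{-r} A`. -/
def pieceMul {s r : ℕ} (g : Piece F A s) (f : Piece F A r) : Piece F A (s + r) :=
  f ≫ (tauPow F A r).map g ≫ eqToHom (tauPow_obj F A s r (ModuleCat.of A A))

/-- The identity of `A`, the unit of the preprojective algebra. -/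
def pieceOne : Piece F A 0 := 𝟙 (ModuleCat.of A A)

theorem pieceMul_zero {s r : ℕ} (g : Piece F A s) : pieceMul F A g (0 : Piece F A r) = 0 := by
  simp [pieceMul]

theorem zero_pieceMul {s r : ℕ} (f : Piece F A r) : pieceMul F A (0 : Piece F A s) f = 0 := by
  simp [pieceMul, Functor.map_zero]

theorem pieceMul_add {s r : ℕ} (g : Piece F A s) (f f' : Piece F A r) :
    pieceMul F A g (f + f') = pieceMul F A g f + pieceMul F A g f' := by
  simp [pieceMul]

theorem add_pieceMul {s r : ℕ} (g g' : Piece F A s) (f : Piece F A r) :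
    pieceMul F A (g + g') f = pieceMul F A g f + pieceMul F A g' f := by
  simp [pieceMul, Functor.map_add]

theorem pieceMul_smul {s r : ℕ} (c : F) (g : Piece F A s) (f : Piece F A r) :
    pieceMul F A g (c • f) = c • pieceMul F A g f := by
  simp [pieceMul]

theorem smul_pieceMul {s r : ℕ} (c : F) (g : Piece F A s) (f : Piece F A r) :
    pieceMul F A (c • g) f = c • pieceMul F A g f := by
  simp [pieceMul, Functor.map_smul]

theorem mk_eq_mk {s r : ℕ} (h : s = r) (f : Piece F A s) (g : Piece F A r)
    (hfg : f ≫ eqToHom (congrArg (T F A) h) = g) :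
    (GradedMonoid.mk s f : GradedMonoid (Piece F A)) = GradedMonoid.mk r g := by
  subst h
  simp only [eqToHom_refl, Category.comp_id] at hfg
  rw [hfg]

theorem mk_one_mul {r : ℕ} (f : Piece F A r) :
    (GradedMonoid.mk (0 + r) (pieceMul F A (pieceOne F A) f) : GradedMonoid (Piece F A)) =
      GradedMonoid.mk r f := by
  refine mk_eq_mk F A (zero_add r) _ _ ?_
  have h : (tauPow F A r).map (pieceOne F A) = 𝟙 _ := (tauPow F A r).map_id _
  calc pieceMul F A (pieceOne F A) f ≫ eqToHom (congrArg (T F A) (zero_add r))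
      = (f ≫ 𝟙 (T F A r) ≫ eqToHom _) ≫ eqToHom _ :=
        congrArg (fun k => (f ≫ k ≫ eqToHom (tauPow_obj F A 0 r (ModuleCat.of A A))) ≫
          eqToHom (congrArg (T F A) (zero_add r))) h
    _ = f := by simp

theorem mul_pieceOne {r : ℕ} (f : Piece F A r) : pieceMul F A f (pieceOne F A) = f := by
  change 𝟙 _ ≫ f ≫ 𝟙 _ = f
  rw [Category.id_comp, Category.comp_id]

theorem mk_mul_assoc {t s r : ℕ} (h : Piece F A t) (g : Piece F A s) (f : Piece F A r) :
    (GradedMonoid.mk (t + s + r) (pieceMul F A (pieceMul F A h g) f) :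
      GradedMonoid (Piece F A)) =
      GradedMonoid.mk (t + (s + r)) (pieceMul F A h (pieceMul F A g f)) := by
  refine mk_eq_mk F A (add_assoc t s r) _ _ ?_
  have key := Functor.congr_hom (tauPow_add F A s r) h
  simp only [Functor.comp_map] at key
  simp only [pieceMul, Functor.map_comp, Category.assoc, key, eqToHom_map, eqToHom_trans]

instance : GradedMonoid.GMul (Piece F A) where
  mul := pieceMul F A

instance : GradedMonoid.GOne (Piece F A) where
  one := pieceOne F A

instance : GradedMonoid.GMonoid (Piece F A) where
  one_mul f := mk_one_mul F A f.2
  mul_one f := congrArg (GradedMonoid.mk f.1) (mul_pieceOne F A f.2)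
  mul_assoc h g f := mk_mul_assoc F A h.2 g.2 f.2

instance : DirectSum.GRing (Piece F A) where
  mul_zero g := pieceMul_zero F A g
  zero_mul f := zero_pieceMul F A f
  mul_add := pieceMul_add F A
  add_mul := add_pieceMul F A
  natCast n := n • pieceOne F A
  natCast_zero := zero_smul _ _
  natCast_succ _ := succ_nsmul _ _
  intCast n := n • pieceOne F A
  intCast_ofNat _ := natCast_zsmul _ _
  intCast_negSucc_ofNat _ := negSucc_zsmul _ _

instance : DirectSum.GAlgebra F (Piece F A) where
  toFun := AddMonoidHom.mk' (fun c : F => c • pieceOne F A) fun a b => add_smul a b _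
  map_one := one_smul F _
  map_mul a b := by
    refine congrArg (GradedMonoid.mk 0) ?_
    change (a * b) • pieceOne F A = pieceMul F A (a • pieceOne F A) (b • pieceOne F A)
    rw [pieceMul_smul, mul_pieceOne, smul_smul, mul_comm]
  commutes c f := by
    have h : GradedMonoid.mk (0 + f.1) (pieceMul F A (c • pieceOne F A) f.2) =
        GradedMonoid.mk f.1 (pieceMul F A f.2 (c • pieceOne F A)) := by
      rw [smul_pieceMul, ← pieceMul_smul, mk_one_mul, pieceMul_smul, mul_pieceOne]
    exact h
  smul_def c f := by
    have h : GradedMonoid.mk f.1 (c • f.2) =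
        GradedMonoid.mk (0 + f.1) (pieceMul F A (c • pieceOne F A) f.2) := by
      rw [smul_pieceMul, ← pieceMul_smul, mk_one_mul]
    exact h

/-- The preprojective algebra `⨁_{r ≥ 0} Hom_A(A, τ^{-r} A)`. For `A = Λ` this is the left
preprojective algebra of `Λ`, for `A = Λᵐᵒᵖ` it is the right one. Its multiplication is
characterized by `of_mul_of'` below. -/
abbrev PreprojAlg : Type u := ⨁ r, Piece F A r

/-- The inclusion of the degree `r` part. -/
abbrev inDeg (r : ℕ) (f : Piece F A r) : PreprojAlg F A := DirectSum.of (Piece F A) r f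

theorem of_mul_of' {s r : ℕ} (g : Piece F A s) (f : Piece F A r) :
    inDeg F A s g * inDeg F A r f =
      inDeg F A (s + r) (f ≫ (tauPow F A r).map g ≫
        eqToHom (tauPow_obj F A s r (ModuleCat.of A A))) :=
  DirectSum.of_mul_of g f

/-- The left ideal `A e`, a direct summand of the regular left module `A` for `e` idempotent. For
`A = Λᵐᵒᵖ` it is the right ideal `e Λ` of `Λ`. -/
def proj (e : A) : ModuleCat.{u} A := ModuleCat.of A (Submodule.span A {e})

/-- The inclusion `A e → A`. -/
def projIncl (e : A) : proj A e ⟶ ModuleCat.of A A :=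
  ModuleCat.ofHom (Submodule.span A {e}).subtype

/-- The map `A → A e`, `x ↦ x e`. -/
def projRetr (e : A) : ModuleCat.of A A ⟶ proj A e :=
  ModuleCat.ofHom (LinearMap.toSpanSingleton A _ ⟨e, Submodule.mem_span_singleton_self e⟩)

/-- A map `A e → τ^{-r}(A e')`, viewed in `Hom_A(A, τ^{-r} A)` via the projection of `A` onto the
summand `A e` and the inclusion of the summand `A e'`. -/
def cornerIncl (r : ℕ) (e e' : A) (f : proj A e ⟶ (tauPow F A r).obj (proj A e')) :
    Piece F A r :=
  projRetr A e ≫ f ≫ (tauPow F A r).map (projIncl A e')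

end Translate

variable (F : Type u) [Field F] (Λ : Type u) [Ring Λ] [Algebra F Λ]

/-- An isomorphism of `Λ`-`Λ`-bimodules from `τ^{-r} Λ` formed with left modules to `τ^{-r} Λ` formed
with right modules. On the former `Λ` acts on the right, and on the latter on the left, by
functoriality. -/
structure BimoduleIso (r : ℕ) extends T F Λ r ≃+ T F Λᵐᵒᵖ r where
  map_left : ∀ (a : Λ) (x : T F Λ r), toFun (a • x) = rightAct F Λᵐᵒᵖ r (op a) (toFun x)
  map_right : ∀ (a : Λ) (x : T F Λ r), toFun (rightAct F Λ r a x) = op a • toFun x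

end

end Preproj

/-! The preprojective algebra is, up to reversing the product, the tensor algebra over `Λ` of the
bimodule `τ⁻Λ`; an anti-isomorphism is therefore determined by what it does in degrees 0 and 1.

Since `Λ` is hereditary, `Ext²` of finite modules vanishes, so `τ⁻ = Ext¹((-)*, Λ)` is right exact
on finite modules (`tauMinus_rightExactOnFinite`). As in the Eilenberg–Watts theorem, `τ⁻M` then has
the universal property of `τ⁻Λ ⊗ M` (`RightExactOnFinite.exists_lift`). Left modules involve `Ext`
over `Λᵐᵒᵖ`, so heredity is needed on the other side as well; duality supplies it
(`FreeSubmodulesProjective.of_op`).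

By iteration, a ring map `Λ → S` and a compatible additive map `τ⁻Λ → S` extend to a ring map from
the preprojective algebra to `Sᵐᵒᵖ` (`RightExactOnFinite.exists_ringHom`), and this extension is
unique (`RightExactOnFinite.ringHom_ext`). The same holds for `Λᵐᵒᵖ`. Hence `θ₁` and its inverse
extend to mutually inverse anti-homomorphisms. They preserve degree; their components are the `θ r`,
and compatibility with the two actions is multiplicativity against degree 0 (`exists_antiIso`).
Uniqueness of `θ` is generation in degrees 0 and 1.

An isomorphism `L₁ ≅ R₁` exists because duality identifies `Ext¹(Λ*, Λ)` with `Ext¹(Λ*, Λ**)` over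
the opposite ring (`exists_ext_dual_equiv`, `nonempty_bimoduleIso_one`). Finally, `Hom(Λe,
τ^{-r}(Λe'))` is the set of `x` in `τ^{-r}Λ` with `e x e' = x`, a condition that a bimodule
isomorphism respects. -/

namespace Preproj

noncomputable section

/-! ### Vector space duality between left and right modules. -/

section Dual

variable {F : Type u} [Field F] {A : Type u} [Ring A] [Algebra F A]

/-- The functional underlying an element of `M*`. -/
def dualApp {M : ModuleCat.{u} A} (φ : dualObj F A M) : Module.Dual F M := φ

/-- A functional, as an element of `M*`. -/
def dualMk {M : ModuleCat.{u} A} (φ : Module.Dual F M) : dualObj F A M := φ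

theorem dual_ext {M : ModuleCat.{u} A} {φ ψ : dualObj F A M}
    (h : ∀ m, dualApp φ m = dualApp ψ m) : φ = ψ :=
  (LinearMap.ext h : dualApp φ = dualApp ψ)

theorem dualApp_smul {M : ModuleCat.{u} A} (a : Aᵐᵒᵖ) (φ : dualObj F A M) (m : M) :
    dualApp (a • φ) m = dualApp φ (a.unop • m) := rfl

theorem dualApp_smul_field {M : ModuleCat.{u} A} (c : F) (φ : dualObj F A M) (m : M) :
    dualApp (c • φ) m = c * dualApp φ m :=
  (map_smul (dualApp φ) c m)

/-- `M*` is the dual vector space. -/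
def dualEquiv (M : ModuleCat.{u} A) : dualObj F A M ≃ₗ[F] Module.Dual F M where
  toFun := dualApp
  invFun := dualMk
  left_inv _ := rfl
  right_inv _ := rfl
  map_add' _ _ := rfl
  map_smul' c φ := LinearMap.ext fun m => dualApp_smul_field c φ m

instance dual_finite (M : ModuleCat.{u} A) [Module.Finite F M] :
    Module.Finite F (dualObj F A M) :=
  Module.Finite.equiv (dualEquiv M).symm

/-- The evaluation map from `M` to its double dual. -/
def evalMap (M : ModuleCat.{u} A) (m : M) : dualObj F Aᵐᵒᵖ (dualObj F A M) :=
  dualMk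
    { toFun := fun φ => dualApp φ m
      map_add' := fun _ _ => rfl
      map_smul' := fun c φ => dualApp_smul_field c φ m }

theorem eq_of_dualApp_eq {M : ModuleCat.{u} A} {m n : M}
    (h : ∀ φ : dualObj F A M, dualApp φ m = dualApp φ n) : m = n := by
  rw [← sub_eq_zero, ← Module.forall_dual_apply_eq_zero_iff F]
  intro φ
  rw [map_sub, sub_eq_zero]
  exact h (dualMk φ)

theorem evalMap_bijective (M : ModuleCat.{u} A) [Module.Finite F M] :
    Function.Bijective (evalMap (F := F) M) := by
  refine ⟨fun m n h => eq_of_dualApp_eq fun φ => congrArg (fun ψ => dualApp ψ φ) h, fun ξ => ?_⟩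
  obtain ⟨m, hm⟩ := (Module.evalEquiv F M).surjective
    ((dualApp ξ).comp (dualEquiv M).symm.toLinearMap)
  exact ⟨m, dual_ext fun φ => LinearMap.congr_fun hm (dualApp φ)⟩

theorem dualMap_faithful {M N : ModuleCat.{u} A} {f g : M ⟶ N}
    (h : dualMap F A f = dualMap F A g) : f = g := by
  refine ModuleCat.hom_ext (LinearMap.ext fun m => eq_of_dualApp_eq (F := F) fun φ => ?_)
  exact congrArg (fun k => dualApp (k φ) m) (congrArg (fun k => k.hom) h)

theorem dualMap_zero (M N : ModuleCat.{u} A) : dualMap F A (0 : M ⟶ N) = 0 :=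
  ModuleCat.hom_ext (LinearMap.ext fun φ => dual_ext fun _ => map_zero (dualApp φ))

/-- Dualize `f` once more: it sends evaluation at `m` to a functional on `N*`, which is evaluation
at a unique `n` because `N` is finite-dimensional. The preimage of `f` is `m ↦ n`. -/
theorem dualMap_full {M N : ModuleCat.{u} A} [Module.Finite F N]
    (f : dualObj F A N ⟶ dualObj F A M) : ∃ g : M ⟶ N, dualMap F A g = f := by
  have h : ∀ m : M, ∃ n : N, ∀ φ, dualApp φ n = dualApp (f φ) m := fun m => by
    obtain ⟨n, hn⟩ := (evalMap_bijective N).2 (dualMap F Aᵐᵒᵖ f (evalMap M m))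
    exact ⟨n, fun φ => congrArg (fun ξ => dualApp ξ φ) hn⟩
  choose g hg using h
  refine ⟨ModuleCat.ofHom
    { toFun := g
      map_add' := fun x y => eq_of_dualApp_eq (F := F) fun φ => ?_
      map_smul' := fun a x => eq_of_dualApp_eq (F := F) fun φ => ?_ }, ?_⟩
  · rw [map_add, hg, hg, hg, map_add]
  · have h1 := hg x (op a • φ)
    rw [map_smul, dualApp_smul, dualApp_smul] at h1
    rw [hg]
    exact h1.symm
  · exact ModuleCat.hom_ext (LinearMap.ext fun φ => dual_ext fun m => hg m φ)

/-- The dual of a short complex. -/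
def dualComplex (F : Type u) [Field F] {A : Type u} [Ring A] [Algebra F A]
    (S : ShortComplex (ModuleCat.{u} A)) : ShortComplex (ModuleCat.{u} Aᵐᵒᵖ) :=
  ShortComplex.mk (dualMap F A S.g) (dualMap F A S.f) (by
    rw [← dualMap_comp, S.zero, dualMap_zero])

/-- Over a field, `S.f` has a linear retraction and `S.g` a linear section; composing functionals
with them gives the required preimages. No finiteness is needed. -/
theorem dualComplex_shortExact {S : ShortComplex (ModuleCat.{u} A)} (hS : S.ShortExact) :
    (dualComplex F S).ShortExact := by
  have hinj : Function.Injective S.f := (ModuleCat.mono_iff_injective _).1 hS.mono_f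
  have hsurj : Function.Surjective S.g := (ModuleCat.epi_iff_surjective _).1 hS.epi_g
  have hex := (ShortComplex.moduleCat_exact_iff S).1 hS.exact
  refine { exact := ?_, mono_f := ?_, epi_g := ?_ }
  · rw [ShortComplex.moduleCat_exact_iff]
    intro φ hφ
    have hφ' : ∀ x, dualApp φ (S.f x) = 0 := fun x => congrArg (fun ψ => dualApp ψ x) hφ
    have hker : LinearMap.ker (S.g.hom.restrictScalars F) ≤ LinearMap.ker (dualApp φ) := by
      intro y hy
      obtain ⟨x, rfl⟩ := hex y hy
      exact hφ' x
    obtain ⟨s, hs⟩ := (S.g.hom.restrictScalars F).exists_rightInverse_of_surjective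
      (LinearMap.range_eq_top.2 hsurj)
    refine ⟨dualMk ((dualApp φ).comp s), dual_ext fun y => ?_⟩
    have h1 : s (S.g y) - y ∈ LinearMap.ker (S.g.hom.restrictScalars F) := by
      rw [LinearMap.mem_ker, map_sub, sub_eq_zero]
      exact LinearMap.congr_fun hs (S.g y)
    have h2 := hker h1
    rw [LinearMap.mem_ker, map_sub, sub_eq_zero] at h2
    exact h2
  · rw [ModuleCat.mono_iff_injective]
    intro φ ψ h
    refine dual_ext fun z => ?_
    obtain ⟨y, rfl⟩ := hsurj z
    exact congrArg (fun χ => dualApp χ y) h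
  · rw [ModuleCat.epi_iff_surjective]
    intro φ
    obtain ⟨s, hs⟩ := (S.f.hom.restrictScalars F).exists_leftInverse_of_injective
      (LinearMap.ker_eq_bot.2 hinj)
    exact ⟨dualMk ((dualApp φ).comp s), dual_ext fun x =>
      congrArg (dualApp φ) (LinearMap.congr_fun hs x)⟩

/-- The free module of rank `n`. -/
def freeObj (A : Type u) [Ring A] (n : ℕ) : ModuleCat.{u} A := ModuleCat.of A (Fin n → A)

/-- The standard basis of the free module. -/
def freeBasis (A : Type u) [Ring A] (n : ℕ) (i : Fin n) : freeObj A n :=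
  (Pi.single i 1 : Fin n → A)

/-- The coordinate functions of the free module. -/
def freeCoord (A : Type u) [Ring A] (n : ℕ) (i : Fin n) : freeObj A n →ₗ[A] A :=
  LinearMap.proj (R := A) (φ := fun _ : Fin n => A) i

/-- The map from the free module to `M` given by a family of elements of `M`. -/
def freeDesc {M : ModuleCat.{u} A} {n : ℕ} (m : Fin n → M) : freeObj A n ⟶ M :=
  ModuleCat.ofHom (∑ i, (LinearMap.toSpanSingleton A M (m i)).comp (freeCoord A n i))

theorem freeDesc_apply {M : ModuleCat.{u} A} {n : ℕ} (m : Fin n → M) (p : freeObj A n) :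
    freeDesc m p = ∑ i, freeCoord A n i p • m i := by
  change (∑ i, (LinearMap.toSpanSingleton A M (m i)).comp (freeCoord A n i)) p = _
  rw [LinearMap.sum_apply]
  rfl

instance freeObj_projective (n : ℕ) : Projective (freeObj A n) :=
  (IsProjective.iff_projective (R := A) (Fin n → A)).1 inferInstance

theorem free_expand (n : ℕ) (p : freeObj A n) :
    ∑ i, freeCoord A n i p • freeBasis A n i = p := by
  have h : ∀ q : Fin n → A, ∑ i, q i • (Pi.single i 1 : Fin n → A) = q := fun q => by
    ext j
    simp [Finset.sum_apply, Pi.single_apply]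
  exact h p

theorem exists_freeDesc_surjective (M : ModuleCat.{u} A) [Module.Finite A M] :
    ∃ (n : ℕ) (m : Fin n → M), Function.Surjective (freeDesc m) := by
  obtain ⟨n, f, hf⟩ := Module.Finite.exists_fin' A M
  refine ⟨n, fun i => f (Pi.single i 1), fun x => ?_⟩
  obtain ⟨p, rfl⟩ := hf x
  refine ⟨p, (freeDesc_apply _ (show freeObj A n from p)).trans ?_⟩
  have h := congrArg f (free_expand n p)
  refine Eq.trans ?_ h
  refine Eq.trans ?_ (map_sum f (fun i => freeCoord A n i p • freeBasis A n i) _).symm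
  exact Finset.sum_congr rfl fun i _ => (map_smul f _ _).symm

/-- A module map into `(Aⁿ)*` amounts to `n` linear functionals, its values at the basis vectors
(`ev`). These extend along a linear retraction `s` of `i`, and the extended functionals define the
map `x ↦ (p ↦ ∑ j, ev j (s (p_j x)))`. -/
instance dual_freeObj_injective (n : ℕ) : Injective (dualObj F A (freeObj A n)) where
  factors {M N} f i hi := by
    have hinj : Function.Injective i := (ModuleCat.mono_iff_injective _).1 hi
    obtain ⟨s, hs⟩ := (i.hom.restrictScalars F).exists_leftInverse_of_injective
      (LinearMap.ker_eq_bot.2 hinj)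
    let ev : Fin n → M →ₗ[F] F := fun j =>
      (dualApp (evalMap (freeObj A n) (freeBasis A n j))) ∘ₗ (f.hom.restrictScalars F)
    let act : N → freeObj A n →ₗ[F] F := fun x =>
      { toFun := fun p => ∑ j, ev j (s (op (freeCoord A n j p) • x))
        map_add' := fun p q => by
          rw [← Finset.sum_add_distrib]
          refine Finset.sum_congr rfl fun j _ => ?_
          rw [← map_add, ← map_add, ← add_smul, ← MulOpposite.op_add, ← map_add]
        map_smul' := fun c p => by
          rw [RingHom.id_apply, smul_eq_mul, Finset.mul_sum]
          refine Finset.sum_congr rfl fun j _ => ?_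
          rw [← smul_eq_mul, ← map_smul, ← map_smul]
          congr 2
          change op (freeCoord A n j (algebraMap F A c • p)) • x =
            algebraMap F Aᵐᵒᵖ c • op (freeCoord A n j p) • x
          rw [smul_smul, map_smul, smul_eq_mul, Algebra.commutes]
          rfl }
    let g : N →ₗ[Aᵐᵒᵖ] dualObj F A (freeObj A n) :=
      { toFun := fun x => dualMk (act x)
        map_add' := fun x y => dual_ext fun p => by
          change ∑ j, ev j (s (op (freeCoord A n j p) • (x + y))) =
            ∑ j, ev j (s (op (freeCoord A n j p) • x)) + ∑ j, ev j (s (op (freeCoord A n j p) • y))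
          rw [← Finset.sum_add_distrib]
          refine Finset.sum_congr rfl fun j _ => ?_
          rw [smul_add, map_add, map_add]
        map_smul' := fun a x => dual_ext fun p => by
          change ∑ j, ev j (s (op (freeCoord A n j p) • a • x)) =
            ∑ j, ev j (s (op (freeCoord A n j (a.unop • p)) • x))
          refine Finset.sum_congr rfl fun j _ => ?_
          rw [smul_smul, (freeCoord A n j).map_smul]
          rfl }
    refine ⟨@ModuleCat.ofHom Aᵐᵒᵖ _ N (dualObj F A (freeObj A n)) _ _ _ _ g, ?_⟩
    refine ModuleCat.hom_ext (LinearMap.ext fun x => dual_ext fun p => ?_)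
    change ∑ j, ev j (s (op (freeCoord A n j p) • i x)) = dualApp (f x) p
    have h1 : ∀ j, ev j (s (op (freeCoord A n j p) • i x)) =
        dualApp (f x) (freeCoord A n j p • freeBasis A n j) := fun j => by
      rw [← map_smul]
      have h2 : s (i (op (freeCoord A n j p) • x)) =
        op (freeCoord A n j p) • x := LinearMap.congr_fun hs _
      rw [h2]
      change dualApp (f (op (freeCoord A n j p) • x)) (freeBasis A n j) = _
      rw [map_smul]
      rfl
    rw [Finset.sum_congr rfl fun j _ => h1 j, ← map_sum, free_expand]

end Dual

/-! ### Heredity: vanishing of `Ext²` and left-right symmetry. -/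

section Hereditary

variable {F : Type u} [Field F] {A : Type u} [Ring A] [Algebra F A]

/-- Submodules of free modules of finite rank are projective. -/
def FreeSubmodulesProjective (A : Type u) [Ring A] : Prop :=
  ∀ (n : ℕ) (N : Submodule A (Fin n → A)), Module.Projective A N

theorem freeSubmodulesProjective_of_isHereditary (h : IsHereditary A) :
    FreeSubmodulesProjective A := fun n N => h (Fin n → A) N

/-- Transport along the ring isomorphism of `A` with its double opposite, which is the ring over
which `τ⁻` of right modules takes its `Ext`. -/
theorem FreeSubmodulesProjective.opop (h : FreeSubmodulesProjective A) :
    FreeSubmodulesProjective Aᵐᵒᵖᵐᵒᵖ := by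
  intro n N
  let σ : A →+* Aᵐᵒᵖᵐᵒᵖ := (RingEquiv.opOp A).toRingHom
  let σ' : Aᵐᵒᵖᵐᵒᵖ →+* A := (RingEquiv.opOp A).symm.toRingHom
  have : RingHomInvPair σ σ' := ⟨rfl, rfl⟩
  have : RingHomInvPair σ' σ := ⟨rfl, rfl⟩
  let N' : Submodule A (Fin n → A) :=
    { carrier := {v | (fun i => op (op (v i))) ∈ N}
      add_mem' := fun hv hw => N.add_mem hv hw
      zero_mem' := N.zero_mem
      smul_mem' := fun a _ hv => N.smul_mem (op (op a)) hv }
  have := h n N'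
  let e : N' ≃ₛₗ[σ] N :=
    { toFun := fun v => ⟨fun i => op (op (v.1 i)), v.2⟩
      invFun := fun v => ⟨fun i => (v.1 i).unop.unop, v.2⟩
      left_inv := fun _ => rfl
      right_inv := fun _ => rfl
      map_add' := fun _ _ => rfl
      map_smul' := fun _ _ => rfl }
  exact Module.Projective.of_equiv e

instance freeObj_finite (n : ℕ) : Module.Finite A (freeObj A n) :=
  inferInstanceAs (Module.Finite A (Fin n → A))

/-- The short complex `ker f → P → M`. -/
def kerComplex {P M : ModuleCat.{u} A} (f : P ⟶ M) : ShortComplex (ModuleCat.{u} A) :=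
  ShortComplex.mk (X₁ := ModuleCat.of A (LinearMap.ker f.hom))
    (ModuleCat.ofHom (LinearMap.ker f.hom).subtype) f
    (ModuleCat.hom_ext (LinearMap.ext fun x => x.2))

theorem kerComplex_shortExact {P M : ModuleCat.{u} A} {f : P ⟶ M}
    (hf : Function.Surjective f) : (kerComplex f).ShortExact where
  exact := (ShortComplex.moduleCat_exact_iff _).2 fun x hx => ⟨⟨x, hx⟩, rfl⟩
  mono_f := (ModuleCat.mono_iff_injective _).2 Subtype.val_injective
  epi_g := (ModuleCat.epi_iff_surjective _).2 hf

instance kerComplex_finite {P M : ModuleCat.{u} A} (f : P ⟶ M) [IsNoetherianRing A]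
    [Module.Finite A P] : Module.Finite A (kerComplex f).X₁ :=
  inferInstanceAs (Module.Finite A (LinearMap.ker f.hom))

/-- The short complex `N → M → M / N`. -/
def quotComplex {M : ModuleCat.{u} A} (N : Submodule A M) : ShortComplex (ModuleCat.{u} A) :=
  ShortComplex.mk (X₁ := ModuleCat.of A N) (X₃ := ModuleCat.of A (M ⧸ N))
    (ModuleCat.ofHom N.subtype) (ModuleCat.ofHom N.mkQ)
    (ModuleCat.hom_ext (LinearMap.ext fun x => (Submodule.Quotient.mk_eq_zero N).2 x.2))

theorem quotComplex_shortExact {M : ModuleCat.{u} A} (N : Submodule A M) :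
    (quotComplex N).ShortExact where
  exact := (ShortComplex.moduleCat_exact_iff _).2 fun x hx =>
    ⟨⟨x, (Submodule.Quotient.mk_eq_zero N).1 hx⟩, rfl⟩
  mono_f := (ModuleCat.mono_iff_injective _).2 Subtype.val_injective
  epi_g := (ModuleCat.epi_iff_surjective _).2 N.mkQ_surjective

/-- Dimension shifting: the kernel of a finite free cover of `V` is projective, so `V` has a
projective resolution of length one. -/
theorem FreeSubmodulesProjective.ext_two_eq_zero (h : FreeSubmodulesProjective A)
    {V : ModuleCat.{u} A} [Module.Finite A V] {Y : ModuleCat.{u} A} (x : Ext V Y 2) : x = 0 := by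
  obtain ⟨n, v, hv⟩ := exists_freeDesc_surjective V
  have hS := kerComplex_shortExact hv
  have : Projective (kerComplex (freeDesc v)).X₁ :=
    have : Module.Projective A (LinearMap.ker (M := freeObj A n) (freeDesc v).hom) := h n _
    (IsProjective.iff_projective (R := A) (LinearMap.ker (M := freeObj A n) (freeDesc v).hom)).1
      this
  have : Projective (kerComplex (freeDesc v)).X₂ := freeObj_projective n
  obtain ⟨y, rfl⟩ := Ext.contravariant_sequence_exact₃ hS Y x
    (Ext.eq_zero_of_projective _) (n₀ := 1) rfl
  exact (congrArg (fun z => hS.extClass.comp z rfl) (Ext.eq_zero_of_projective y)).trans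
    (Ext.comp_zero _ _ _ _ _)

variable (F) in
theorem finite_field (M : ModuleCat.{u} A) [FiniteDimensional F A] [Module.Finite A M] :
    Module.Finite F M := Module.Finite.trans A M

theorem finite_of_finite_field (M : ModuleCat.{u} A) [Module.Finite F M] :
    Module.Finite A M := Module.Finite.of_restrictScalars_finite F A M

variable (F) in
theorem isNoetherianRing_of_finiteDimensional (A : Type u) [Ring A] [Algebra F A]
    [FiniteDimensional F A] : IsNoetherianRing A :=
  isNoetherian_of_tower F inferInstance

theorem dual_finite_module [FiniteDimensional F A] (M : ModuleCat.{u} A) [Module.Finite A M] :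
    Module.Finite Aᵐᵒᵖ (dualObj F A M) :=
  have := finite_field F M
  finite_of_finite_field (F := F) (dualObj F A M)

/-- Over a finite-dimensional algebra, being hereditary is left-right symmetric. -/
theorem FreeSubmodulesProjective.of_op [FiniteDimensional F A]
    (h : FreeSubmodulesProjective Aᵐᵒᵖ) : FreeSubmodulesProjective A := by
  intro n N
  have := isNoetherianRing_of_finiteDimensional F A
  have : Module.Finite A N := inferInstance
  let M : ModuleCat.{u} A := ModuleCat.of A N
  have : Module.Finite A M := this
  obtain ⟨m, v, hv⟩ := exists_freeDesc_surjective M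
  have hS₁ := dualComplex_shortExact (F := F) (quotComplex_shortExact (M := freeObj A n) N)
  have hS₂ := dualComplex_shortExact (F := F) (kerComplex_shortExact hv)
  have : Injective (dualComplex F (quotComplex (M := freeObj A n) N)).X₂ :=
    dual_freeObj_injective n
  have : Module.Finite Aᵐᵒᵖ (dualComplex F (kerComplex (freeDesc v))).X₃ :=
    dual_finite_module (F := F) (kerComplex (freeDesc v)).X₁
  -- `N*` is a quotient of the injective `(Aⁿ)*`, so `Ext¹` into it embeds in an `Ext²`, which
  -- vanishes by heredity of the opposite ring.
  have key : ∀ x : Ext (dualComplex F (kerComplex (freeDesc v))).X₃ (dualObj F A M) 1, x = 0 := by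
    intro x
    obtain ⟨y, rfl⟩ := Ext.covariant_sequence_exact₃ _ hS₁ x (n₁ := 2) rfl (h.ext_two_eq_zero _)
    exact (congrArg (fun z => Ext.comp z (Ext.mk₀ _) (add_zero 1)) (Ext.eq_zero_of_injective y)).trans
      (Ext.zero_comp _ _ _ _ _)
  -- The obstruction to extending the identity of `N*` to the dual of the free cover vanishes, so
  -- the dual sequence splits; the retraction is the dual of a section of the cover, and `N` is
  -- projective.
  obtain ⟨z, hz⟩ := Ext.contravariant_sequence_exact₁ hS₂ (dualObj F A M)
    (Ext.mk₀ (𝟙 (dualObj F A M))) (n₁ := 1) rfl (key _)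
  obtain ⟨ρ, rfl⟩ := (Ext.mk₀_bijective _ _).2 z
  rw [Ext.mk₀_comp_mk₀] at hz
  replace hz := (Ext.mk₀_bijective _ _).1 hz
  have : Module.Finite F (freeObj A m) := finite_field F (freeObj A m)
  obtain ⟨s, rfl⟩ := dualMap_full (M := M) (N := freeObj A m) ρ
  have hs : s ≫ freeDesc v = 𝟙 M := dualMap_faithful (F := F) hz
  exact Module.Projective.of_split (M := freeObj A m) s.hom (freeDesc v).hom
    (congrArg (fun k => k.hom) hs)

end Hereditary

/-! ### Right exactness and finiteness of `τ⁻`. -/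

section RightExact

variable {F : Type u} [Field F] {A : Type u} [Ring A] [Algebra F A]

/-- Right exactness of an endofunctor on short exact sequences of finite modules. -/
def RightExactOnFinite (G : ModuleCat.{u} A ⥤ ModuleCat.{u} A) : Prop :=
  ∀ S : ShortComplex (ModuleCat.{u} A), S.ShortExact → Module.Finite A S.X₁ →
    Function.Surjective (G.map S.g) ∧ ∀ y, G.map S.g y = 0 → ∃ x, G.map S.f x = y

/-- This is the tail of the long exact sequence of `Ext(-, A)` for the dual sequence: the next term
is `Ext²(S.X₁*, A) = 0`, and this is where finiteness of `S.X₁` enters. -/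
theorem tauMinus_rightExactOnFinite [FiniteDimensional F A]
    (h : FreeSubmodulesProjective Aᵐᵒᵖ) : RightExactOnFinite (tauMinus F A) := by
  intro S hS hfin
  have hD := dualComplex_shortExact (F := F) hS
  have hfin' : Module.Finite Aᵐᵒᵖ (dualComplex F S).X₃ := dual_finite_module (F := F) S.X₁
  refine ⟨fun x => ?_, fun y hy => ?_⟩
  · exact Ext.contravariant_sequence_exact₁ hD (rightRegular A) (n₀ := 1)
      (show Ext (dualObj F A S.X₃) (rightRegular A) 1 from x) (n₁ := 2) rfl (h.ext_two_eq_zero _)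
  · exact Ext.contravariant_sequence_exact₂ hD (rightRegular A) (n := 1)
      (show Ext (dualObj F A S.X₂) (rightRegular A) 1 from y) hy

theorem hom_finite (M N : ModuleCat.{u} A) [Module.Finite F M] [Module.Finite F N] :
    Module.Finite F (M ⟶ N) := by
  let e : (M ⟶ N) →ₗ[F] (M →ₗ[F] N) :=
    { toFun := fun f => f.hom.restrictScalars F
      map_add' := fun _ _ => rfl
      map_smul' := fun _ _ => rfl }
  exact Module.Finite.of_injective e fun f g h =>
    ModuleCat.hom_ext (LinearMap.ext fun x => LinearMap.congr_fun h x)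

/-- With `K` the kernel of a finite free cover of `M*`, the connecting map `δ` presents `Ext¹(M*,
A)` as a quotient of the finite-dimensional space `Hom(K, A)`. -/
theorem tauMinus_finite [FiniteDimensional F A] (M : ModuleCat.{u} A) [Module.Finite A M] :
    Module.Finite A ((tauMinus F A).obj M) := by
  have := isNoetherianRing_of_finiteDimensional F Aᵐᵒᵖ
  have := dual_finite_module (F := F) M
  obtain ⟨n, v, hv⟩ := exists_freeDesc_surjective (dualObj F A M)
  have hS := kerComplex_shortExact hv
  have : Projective (kerComplex (freeDesc v)).X₂ := freeObj_projective n
  let K : ModuleCat.{u} Aᵐᵒᵖ := (kerComplex (freeDesc v)).X₁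
  have : Module.Finite F K :=
    have : Module.Finite Aᵐᵒᵖ K := kerComplex_finite (P := freeObj Aᵐᵒᵖ n) _
    finite_field F K
  have : Module.Finite F (rightRegular A) :=
    have : Module.Finite Aᵐᵒᵖ (rightRegular A) :=
      Module.Finite.of_surjective (M := Aᵐᵒᵖ)
        (LinearMap.toSpanSingleton Aᵐᵒᵖ (rightRegular A) (1 : A)) fun a =>
          ⟨op (show A from a), one_mul (show A from a)⟩
    finite_field F (rightRegular A)
  have hom_fin := hom_finite (F := F) K (rightRegular A)
  obtain ⟨s, hs⟩ := hom_fin.fg_top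
  let δ : (K ⟶ rightRegular A) → (tauMinus F A).obj M := fun f =>
    hS.extClass.comp (Ext.mk₀ f) (add_zero 1)
  have hδ : Function.Surjective δ := fun x => by
    obtain ⟨y, hy⟩ := Ext.contravariant_sequence_exact₃ hS (rightRegular A)
      (show Ext (dualObj F A M) (rightRegular A) 1 from x) (Ext.eq_zero_of_projective _)
      (n₀ := 0) rfl
    obtain ⟨f, rfl⟩ := (Ext.mk₀_bijective _ _).2 y
    exact ⟨f, hy⟩
  classical
  refine ⟨⟨s.image δ, eq_top_iff.2 fun x _ => ?_⟩⟩
  obtain ⟨f, rfl⟩ := hδ x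
  have hf : f ∈ Submodule.span F (s : Set (K ⟶ rightRegular A)) := hs ▸ Submodule.mem_top
  induction hf using Submodule.span_induction with
  | mem f hf => exact Submodule.subset_span (Finset.mem_coe.2 (Finset.mem_image_of_mem δ hf))
  | zero =>
    have h0 : δ 0 = 0 := by
      change hS.extClass.comp (Ext.mk₀ 0) (add_zero 1) = 0
      rw [Ext.mk₀_zero, Ext.comp_zero]
    rw [h0]
    exact Submodule.zero_mem _
  | add f g _ _ hf hg =>
    have h0 : δ (f + g) = δ f + δ g := by
      change hS.extClass.comp (Ext.mk₀ (f + g)) (add_zero 1) = _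
      rw [Ext.mk₀_add, Ext.comp_add]
      rfl
    rw [h0]
    exact Submodule.add_mem _ (hf trivial) (hg trivial)
  | smul c f _ hf =>
    have h0 : δ (c • f) = algebraMap F A c • δ f := by
      change hS.extClass.comp (Ext.mk₀ (c • f)) (add_zero 1) =
        (hS.extClass.comp (Ext.mk₀ f) (add_zero 1)).comp
          (Ext.mk₀ (lmul A (algebraMap F A c))) (add_zero 1)
      rw [Ext.comp_assoc_of_third_deg_zero, Ext.mk₀_comp_mk₀, lmul_algebraMap,
        Linear.comp_smul, Category.comp_id]
    rw [h0]
    exact Submodule.smul_mem _ _ (hf trivial)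

/-- The map `A → M`, `a ↦ a m`. -/
def elemMap {M : ModuleCat.{u} A} (m : M) : ModuleCat.of A A ⟶ M :=
  ModuleCat.ofHom (LinearMap.toSpanSingleton A M m)

theorem elemMap_comp {M N : ModuleCat.{u} A} (m : M) (f : M ⟶ N) :
    elemMap m ≫ f = elemMap (f m) :=
  ModuleCat.hom_ext (LinearMap.ext fun a => map_smul f.hom a m)

theorem elemMap_add {M : ModuleCat.{u} A} (m n : M) : elemMap (m + n) = elemMap m + elemMap n :=
  ModuleCat.hom_ext (LinearMap.ext fun a => smul_add a m n)

theorem elemMap_smul {M : ModuleCat.{u} A} (a : A) (m : M) :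
    elemMap (a • m) = rmul A a ≫ elemMap m :=
  ModuleCat.hom_ext (LinearMap.ext fun b => (mul_smul b a m).symm)

theorem elemMap_one {M : ModuleCat.{u} A} (f : ModuleCat.of A A ⟶ M) :
    elemMap (f (1 : A)) = f :=
  ModuleCat.hom_ext (LinearMap.ext_ring (one_smul A (f (1 : A))))

theorem elemMap_apply_one {M : ModuleCat.{u} A} (m : M) : elemMap m (1 : A) = m :=
  one_smul A m

theorem elemMap_injective {M : ModuleCat.{u} A} {m n : M} (h : elemMap m = elemMap n) : m = n := by
  rw [← elemMap_apply_one m, h, elemMap_apply_one]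

/-- The coordinate maps of a free module, as morphisms. -/
def coordHom (A : Type u) [Ring A] (n : ℕ) (i : Fin n) : freeObj A n ⟶ ModuleCat.of A A :=
  ModuleCat.ofHom (freeCoord A n i)

theorem sum_coordHom_comp_elemMap (n : ℕ) :
    ∑ i, coordHom A n i ≫ elemMap (freeBasis A n i) = 𝟙 (freeObj A n) := by
  refine ModuleCat.hom_ext (LinearMap.ext fun p => ?_)
  rw [ModuleCat.hom_sum, LinearMap.sum_apply]
  exact free_expand n p

/-! ### An Eilenberg–Watts property: `G M` behaves as `G A ⊗ M`. -/

section Universal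

variable {G : ModuleCat.{u} A ⥤ ModuleCat.{u} A} [G.Additive]

theorem eq_sum_map_elemMap (n : ℕ) (z : G.obj (freeObj A n)) :
    z = ∑ i, G.map (elemMap (freeBasis A n i)) (G.map (coordHom A n i) z) := by
  have h := congrArg (fun k => G.map k z) (sum_coordHom_comp_elemMap (A := A) n)
  simp only [CategoryTheory.Functor.map_id] at h
  refine h.symm.trans ?_
  rw [Functor.map_sum]
  refine (LinearMap.congr_fun (ModuleCat.hom_sum _ _) z).trans ?_
  rw [LinearMap.sum_apply]
  refine Finset.sum_congr rfl fun i _ => ?_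
  rw [G.map_comp]
  rfl

variable (hG : RightExactOnFinite G) [IsNoetherianRing A]
include hG

/-- The elements `G.map (elemMap m) x` play the role of the pure tensors `x ⊗ m`. They generate `G
M`: a finite free cover stays surjective under `G`, and additivity of `G` reduces free modules to
`A`. -/
theorem RightExactOnFinite.addHom_ext {X : Type*} [AddCommGroup X] {M : ModuleCat.{u} A}
    [Module.Finite A M] {γ γ' : G.obj M →+ X}
    (h : ∀ (m : M) (x : G.obj (ModuleCat.of A A)),
      γ (G.map (elemMap m) x) = γ' (G.map (elemMap m) x)) : γ = γ' := by
  obtain ⟨n, v, hv⟩ := exists_freeDesc_surjective M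
  ext z
  obtain ⟨y, rfl⟩ := (hG _ (kerComplex_shortExact hv) (kerComplex_finite (P := freeObj A n) _)).1 z
  rw [eq_sum_map_elemMap n y]
  change γ (G.map (freeDesc v) _) = γ' (G.map (freeDesc v) _)
  rw [map_sum, map_sum, map_sum]
  refine Finset.sum_congr rfl fun i _ => ?_
  rw [← ModuleCat.comp_apply, ← G.map_comp, elemMap_comp, h]

/-- `G M` has the universal property of the tensor product `G A ⊗ M`. -/
theorem RightExactOnFinite.exists_lift {X : Type*} [AddCommGroup X] {M : ModuleCat.{u} A}
    [Module.Finite A M] (β : G.obj (ModuleCat.of A A) →+ M →+ X)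
    (hβ : ∀ (x : G.obj (ModuleCat.of A A)) (a : A) (m : M),
      β (G.map (rmul A a) x) m = β x (a • m)) :
    ∃ γ : G.obj M →+ X, ∀ (m : M) (x : G.obj (ModuleCat.of A A)),
      γ (G.map (elemMap m) x) = β x m := by
  obtain ⟨n, v, hv⟩ := exists_freeDesc_surjective M
  have hS := kerComplex_shortExact hv
  have hK : Module.Finite A (kerComplex (freeDesc v)).X₁ := kerComplex_finite (P := freeObj A n) _
  obtain ⟨h₁, h₂⟩ := hG _ hS hK
  -- The lift is forced on a free cover. It descends to `G M` because it kills the image of `G` of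
  -- the kernel, which `addHom_ext` reduces to pure tensors; the kernel is finite since `A` is
  -- Noetherian.
  let γ' : G.obj (freeObj A n) →+ X := ∑ i,
    (β.flip (v i)).comp (G.map (coordHom A n i)).hom.toAddMonoidHom
  have hγ' : ∀ z, γ' z = ∑ i, β (G.map (coordHom A n i) z) (v i) := fun z => by
    rw [AddMonoidHom.finsetSum_apply]
    rfl
  have key : ∀ (p : freeObj A n) (x : G.obj (ModuleCat.of A A)),
      γ' (G.map (elemMap p) x) = β x (freeDesc v p) := fun p x => by
    rw [hγ', freeDesc_apply, map_sum]
    refine Finset.sum_congr rfl fun i _ => ?_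
    rw [← ModuleCat.comp_apply, ← G.map_comp, elemMap_comp, ← hβ]
    rfl
  have hzero : γ'.comp (G.map (kerComplex (freeDesc v)).f).hom.toAddMonoidHom = 0 := by
    refine hG.addHom_ext fun k x => ?_
    change γ' (G.map (kerComplex (freeDesc v)).f (G.map (elemMap k) x)) = 0
    rw [← ModuleCat.comp_apply, ← G.map_comp, elemMap_comp]
    refine (key _ x).trans ?_
    have hk : freeDesc v ((kerComplex (freeDesc v)).f k) = 0 := k.2
    rw [hk, map_zero]
  have hker : (G.map (freeDesc v)).hom.toAddMonoidHom.ker ≤ γ'.ker := by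
    intro y hy
    obtain ⟨x, rfl⟩ := h₂ y hy
    exact DFunLike.congr_fun hzero x
  have h₁' : Function.RightInverse (Function.surjInv h₁)
      (G.map (freeDesc v)).hom.toAddMonoidHom := Function.surjInv_eq h₁
  refine ⟨(G.map (freeDesc v)).hom.toAddMonoidHom.liftOfRightInverse _ h₁' ⟨γ', hker⟩,
    fun m x => ?_⟩
  obtain ⟨p, rfl⟩ := hv m
  rw [← key, ← elemMap_comp, G.map_comp, ModuleCat.comp_apply]
  exact AddMonoidHom.liftOfRightInverse_comp_apply _ _ h₁' ⟨γ', hker⟩ _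

end Universal

end RightExact

/-! ### Duality on `Ext¹` and the isomorphism `L₁ ≅ R₁`. -/

section ExtDuality

variable {F : Type u} [Field F] {A : Type u} [Ring A] [Algebra F A]

theorem exists_addEquiv_of_ker_eq {H E E' : Type*} [AddCommGroup H] [AddCommGroup E]
    [AddCommGroup E'] (δ : H →+ E) (δ' : H →+ E') (hδ : Function.Surjective δ)
    (hδ' : Function.Surjective δ') (h : δ.ker = δ'.ker) :
    ∃ e : E ≃+ E', ∀ x, e (δ x) = δ' x := by
  refine ⟨(QuotientAddGroup.quotientKerEquivOfSurjective δ hδ).symm.trans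
    ((QuotientAddGroup.quotientAddEquivOfEq h).trans
      (QuotientAddGroup.quotientKerEquivOfSurjective δ' hδ')), fun x => ?_⟩
  have h₁ : (QuotientAddGroup.quotientKerEquivOfSurjective δ hδ).symm (δ x) =
      QuotientAddGroup.mk x := by
    rw [AddEquiv.symm_apply_eq]
    rfl
  rw [AddEquiv.trans_apply, h₁]
  rfl

/-- Duality on `Ext¹` of finite-dimensional modules. -/
theorem exists_ext_dual_equiv [FiniteDimensional F A] (X Y : ModuleCat.{u} A)
    [Module.Finite A X] [Module.Finite A Y] :
    ∃ Φ : Ext X Y 1 ≃+ Ext (dualObj F A Y) (dualObj F A X) 1,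
      (∀ (a : Y ⟶ Y) (x : Ext X Y 1), Φ (x.comp (Ext.mk₀ a) (add_zero 1)) =
        (Ext.mk₀ (dualMap F A a)).comp (Φ x) (zero_add 1)) ∧
      ∀ (b : X ⟶ X) (x : Ext X Y 1), Φ ((Ext.mk₀ b).comp x (zero_add 1)) =
        (Φ x).comp (Ext.mk₀ (dualMap F A b)) (add_zero 1) := by
  obtain ⟨n, v, hv⟩ := exists_freeDesc_surjective X
  have : Module.Finite F Y := finite_field F Y
  have : Module.Finite F (freeObj A n) := finite_field F (freeObj A n)
  obtain ⟨K, ι, zero, hS⟩ : ∃ (K : ModuleCat.{u} A) (ι : K ⟶ freeObj A n)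
      (zero : ι ≫ freeDesc v = 0), (ShortComplex.mk ι (freeDesc v) zero).ShortExact :=
    ⟨_, _, _, kerComplex_shortExact hv⟩
  have hD := dualComplex_shortExact (F := F) hS
  have : Projective (ShortComplex.mk ι (freeDesc v) zero).X₂ := freeObj_projective n
  have : Injective (dualComplex F (ShortComplex.mk ι (freeDesc v) zero)).X₂ :=
    dual_freeObj_injective n
  let ε : Ext X K 1 := hS.extClass
  let ε' : Ext (dualObj F A K) (dualObj F A X) 1 := hD.extClass
  let δ : (K ⟶ Y) →+ Ext X Y 1 := AddMonoidHom.mk'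
    (fun f => ε.comp (Ext.mk₀ f) (add_zero 1)) fun f g => by rw [Ext.mk₀_add, Ext.comp_add]
  let δ' : (K ⟶ Y) →+ Ext (dualObj F A Y) (dualObj F A X) 1 := AddMonoidHom.mk'
    (fun f => (Ext.mk₀ (dualMap F A f)).comp ε' (zero_add 1)) fun f g => by
      rw [dualMap_add, Ext.mk₀_add, Ext.add_comp]
  have hδ : Function.Surjective δ := fun x => by
    obtain ⟨y, hy⟩ := Ext.contravariant_sequence_exact₃ hS Y x (Ext.eq_zero_of_projective _)
      (n₀ := 0) rfl
    obtain ⟨f, rfl⟩ := (Ext.mk₀_bijective _ _).2 y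
    exact ⟨f, hy⟩
  have hδ' : Function.Surjective δ' := fun x => by
    obtain ⟨y, hy⟩ := Ext.covariant_sequence_exact₁ (dualObj F A Y) hD x
      (Ext.eq_zero_of_injective _) (n₀ := 0) rfl
    obtain ⟨f', rfl⟩ := (Ext.mk₀_bijective _ _).2 y
    obtain ⟨f, rfl⟩ := dualMap_full (M := K) (N := Y) f'
    exact ⟨f, hy⟩
  -- Both `Ext` groups are quotients of `Hom(K, Y)`, by the connecting map of the free presentation
  -- of `X` and by that of its dual. Either connecting map kills exactly the `f` that factor through
  -- `ι`.
  have hker : δ.ker = δ'.ker := by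
    ext f
    rw [AddMonoidHom.mem_ker, AddMonoidHom.mem_ker]
    constructor
    · intro hf
      obtain ⟨y, hy⟩ := Ext.contravariant_sequence_exact₁ hS Y (Ext.mk₀ f) (n₁ := 1) rfl hf
      obtain ⟨g, rfl⟩ := (Ext.mk₀_bijective _ _).2 y
      rw [Ext.mk₀_comp_mk₀] at hy
      obtain rfl : ι ≫ g = f := (Ext.mk₀_bijective _ _).1 hy
      change (Ext.mk₀ (dualMap F A (ι ≫ g))).comp ε' (zero_add 1) = 0
      rw [dualMap_comp, ← Ext.mk₀_comp_mk₀_assoc]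
      exact (congrArg (fun z => (Ext.mk₀ (dualMap F A g)).comp z (zero_add 1))
        hD.comp_extClass).trans (Ext.comp_zero _ _ _ _ _)
    · intro hf
      obtain ⟨y, hy⟩ := Ext.covariant_sequence_exact₃ (dualObj F A Y) hD
        (Ext.mk₀ (dualMap F A f)) (n₁ := 1) rfl hf
      obtain ⟨g', rfl⟩ := (Ext.mk₀_bijective _ _).2 y
      rw [Ext.mk₀_comp_mk₀] at hy
      obtain ⟨g, rfl⟩ := dualMap_full (M := freeObj A n) (N := Y) g'
      obtain rfl : ι ≫ g = f := dualMap_faithful (F := F) ((Ext.mk₀_bijective _ _).1 hy)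
      change ε.comp (Ext.mk₀ (ι ≫ g)) (add_zero 1) = 0
      rw [← Ext.mk₀_comp_mk₀]
      exact hS.extClass_comp_assoc (Ext.mk₀ g)
  obtain ⟨Φ, hΦ⟩ := exists_addEquiv_of_ker_eq δ δ' hδ hδ' hker
  refine ⟨Φ, fun a x => ?_, fun b x => ?_⟩
  · obtain ⟨f, rfl⟩ := hδ x
    have h₁ : (δ f).comp (Ext.mk₀ a) (add_zero 1) = δ (f ≫ a) := by
      change (ε.comp (Ext.mk₀ f) (add_zero 1)).comp (Ext.mk₀ a) (add_zero 1) =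
        ε.comp (Ext.mk₀ (f ≫ a)) (add_zero 1)
      rw [Ext.comp_assoc_of_third_deg_zero, Ext.mk₀_comp_mk₀]
    rw [h₁, hΦ, hΦ]
    change (Ext.mk₀ (dualMap F A (f ≫ a))).comp ε' (zero_add 1) =
      (Ext.mk₀ (dualMap F A a)).comp ((Ext.mk₀ (dualMap F A f)).comp ε' (zero_add 1)) (zero_add 1)
    rw [dualMap_comp, Ext.mk₀_comp_mk₀_assoc]
  · obtain ⟨f, rfl⟩ := hδ x
    have : Epi (freeDesc v) := hS.epi_g
    have : Mono ι := hS.mono_f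
    -- To move `b` across `Φ`, lift it to the free cover and restrict the lift to `K`. Naturality of
    -- the extension class, for the presentation and for its dual, then trades `b` for `k`.
    let c : freeObj A n ⟶ freeObj A n := Projective.factorThru (freeDesc v ≫ b) (freeDesc v)
    have hc : c ≫ freeDesc v = freeDesc v ≫ b := Projective.factorThru_comp _ _
    obtain ⟨k, hk⟩ : ∃ k : K ⟶ K, k ≫ ι = ι ≫ c := by
      have h0 : (ι ≫ c) ≫ freeDesc v = 0 := by
        rw [Category.assoc, hc, reassoc_of% zero, Limits.zero_comp]
      exact ⟨hS.exact.lift (ι ≫ c) h0, hS.exact.lift_f (ι ≫ c) h0⟩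
    have e₁ : ε.comp (Ext.mk₀ k) (add_zero 1) = (Ext.mk₀ b).comp ε (zero_add 1) :=
      ShortComplex.ShortExact.extClass_naturality hS hS ⟨k, c, b, hk, hc⟩
    have e₂ : ε'.comp (Ext.mk₀ (dualMap F A b)) (add_zero 1) =
        (Ext.mk₀ (dualMap F A k)).comp ε' (zero_add 1) :=
      ShortComplex.ShortExact.extClass_naturality hD hD
        ⟨dualMap F A b, dualMap F A c, dualMap F A k,
          congrArg (dualMap F A) hc.symm, congrArg (dualMap F A) hk.symm⟩
    have h₁ : (Ext.mk₀ b).comp (δ f) (zero_add 1) = δ (k ≫ f) := by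
      change (Ext.mk₀ b).comp (ε.comp (Ext.mk₀ f) (add_zero 1)) (zero_add 1) =
        ε.comp (Ext.mk₀ (k ≫ f)) (add_zero 1)
      rw [← Ext.mk₀_comp_mk₀, ← Ext.comp_assoc_of_third_deg_zero, ← e₁,
        Ext.comp_assoc_of_third_deg_zero]
    rw [h₁, hΦ, hΦ]
    change (Ext.mk₀ (dualMap F A (k ≫ f))).comp ε' (zero_add 1) =
      ((Ext.mk₀ (dualMap F A f)).comp ε' (zero_add 1)).comp (Ext.mk₀ (dualMap F A b)) (add_zero 1)
    rw [dualMap_comp, ← Ext.mk₀_comp_mk₀_assoc, ← e₂, Ext.comp_assoc_of_third_deg_zero]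

/-- `op` as an isomorphism of right modules. -/
def rightRegularIso (A : Type u) [Ring A] : rightRegular A ≅ ModuleCat.of Aᵐᵒᵖ Aᵐᵒᵖ :=
  (LinearEquiv.toModuleIso
    ({ toFun := fun x => op x
       invFun := fun y => unop y
       left_inv := fun _ => rfl
       right_inv := fun _ => rfl
       map_add' := fun _ _ => rfl
       map_smul' := fun _ _ => rfl } : A ≃ₗ[Aᵐᵒᵖ] Aᵐᵒᵖ) : ModuleCat.of Aᵐᵒᵖ A ≅ _)

theorem lmul_comp_rightRegularIso (a : A) :
    lmul A a ≫ (rightRegularIso A).hom = (rightRegularIso A).hom ≫ rmul Aᵐᵒᵖ (op a) := rfl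

variable (F A) in
/-- The evaluation map `A → A**`. -/
def evalHom : rightRegular Aᵐᵒᵖ ⟶ dualObj F Aᵐᵒᵖ (dualObj F A (ModuleCat.of A A)) :=
  @ModuleCat.ofHom Aᵐᵒᵖᵐᵒᵖ _ (rightRegular Aᵐᵒᵖ)
    (dualObj F Aᵐᵒᵖ (dualObj F A (ModuleCat.of A A))) _ _ _ _
    { toFun := fun x : Aᵐᵒᵖ => evalMap (F := F) (ModuleCat.of A A) (unop x)
      map_add' := fun x y => dual_ext fun φ => map_add (dualApp φ) (unop x : A) (unop y : A)
      map_smul' := fun _ _ => rfl }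

theorem evalMap_bijective_of_finite [FiniteDimensional F A] (M : ModuleCat.{u} A)
    [Module.Finite A M] : Function.Bijective (evalMap (F := F) M) :=
  have := finite_field F M
  evalMap_bijective M

theorem evalHom_isIso [FiniteDimensional F A] : IsIso (evalHom F A) := by
  refine (ConcreteCategory.isIso_iff_bijective _).2 ?_
  exact (evalMap_bijective_of_finite (F := F) (ModuleCat.of A A)).comp MulOpposite.unop_bijective

theorem lmul_comp_evalHom (a : A) :
    lmul Aᵐᵒᵖ (op a) ≫ evalHom F A =
      evalHom F A ≫ dualMap F Aᵐᵒᵖ (dualMap F A (rmul A a)) := rfl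

/-- Duality with `X = A*` and `Y = A` lands in `Ext¹(A*, A**)` over the double opposite; `p`
replaces the right module `A` by `Aᵐᵒᵖ`, and `q` identifies `A**` with `A`. Since duality swaps the
two arguments of `Ext`, it swaps the action through the coefficients with the functorial one. -/
theorem nonempty_bimoduleIso_one [FiniteDimensional F A] : Nonempty (BimoduleIso F A 1) := by
  have : Module.Finite Aᵐᵒᵖ (dualObj F A (ModuleCat.of A A)) := dual_finite_module _
  have : Module.Finite Aᵐᵒᵖ (rightRegular A) :=
    Module.Finite.equiv (R := Aᵐᵒᵖ) (rightRegularIso A).symm.toLinearEquiv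
  obtain ⟨Φ, hY, hX⟩ := exists_ext_dual_equiv (F := F)
    (dualObj F A (ModuleCat.of A A)) (rightRegular A)
  have := evalHom_isIso (F := F) (A := A)
  let q := asIso (evalHom F A)
  let p := dualMap F Aᵐᵒᵖ (rightRegularIso A).hom
  let p' := dualMap F Aᵐᵒᵖ (rightRegularIso A).inv
  have hpp' : p ≫ p' = 𝟙 _ := by
    rw [← dualMap_comp, Iso.inv_hom_id, dualMap_id]
  have hp'p : p' ≫ p = 𝟙 _ := by
    rw [← dualMap_comp, Iso.hom_inv_id, dualMap_id]
  let e : Ext (dualObj F Aᵐᵒᵖ (rightRegular A))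
      (dualObj F Aᵐᵒᵖ (dualObj F A (ModuleCat.of A A))) 1 ≃+
      Ext (dualObj F Aᵐᵒᵖ (ModuleCat.of Aᵐᵒᵖ Aᵐᵒᵖ)) (rightRegular Aᵐᵒᵖ) 1 :=
    { toFun := fun y => (Ext.mk₀ p).comp (y.comp (Ext.mk₀ q.inv) (add_zero 1)) (zero_add 1)
      invFun := fun y => (Ext.mk₀ p').comp (y.comp (Ext.mk₀ q.hom) (add_zero 1)) (zero_add 1)
      left_inv := fun y => by
        dsimp only
        rw [← Ext.comp_assoc_of_third_deg_zero (Ext.mk₀ p), Ext.comp_assoc_of_third_deg_zero,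
          Ext.mk₀_comp_mk₀, Ext.comp_assoc_of_third_deg_zero, Ext.mk₀_comp_mk₀_assoc]
        simp [hp'p]
      right_inv := fun y => by
        dsimp only
        rw [← Ext.comp_assoc_of_third_deg_zero (Ext.mk₀ p'), Ext.comp_assoc_of_third_deg_zero,
          Ext.mk₀_comp_mk₀, Ext.comp_assoc_of_third_deg_zero, Ext.mk₀_comp_mk₀_assoc]
        simp [hpp']
      map_add' := fun y z => by rw [Ext.add_comp, Ext.comp_add] }
  have he : ∀ y, e y = (Ext.mk₀ p).comp (y.comp (Ext.mk₀ q.inv) (add_zero 1)) (zero_add 1) :=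
    fun _ => rfl
  refine ⟨{ Φ.trans e with map_left := fun a => ?_, map_right := fun a => ?_ }⟩
  · have h : ∀ x : Ext (dualObj F A (ModuleCat.of A A)) (rightRegular A) 1,
        e (Φ (x.comp (Ext.mk₀ (lmul A a)) (add_zero 1))) =
          (Ext.mk₀ (dualMap F Aᵐᵒᵖ (rmul Aᵐᵒᵖ (op a)))).comp (e (Φ x)) (zero_add 1) := fun x => by
      rw [hY, he, he, Ext.comp_assoc_of_third_deg_zero, Ext.mk₀_comp_mk₀_assoc,
        Ext.mk₀_comp_mk₀_assoc, ← dualMap_comp, ← dualMap_comp, lmul_comp_rightRegularIso]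
    exact h
  · have h : ∀ x : Ext (dualObj F A (ModuleCat.of A A)) (rightRegular A) 1,
        e (Φ ((Ext.mk₀ (dualMap F A (rmul A a))).comp x (zero_add 1))) =
          (e (Φ x)).comp (Ext.mk₀ (lmul Aᵐᵒᵖ (op a))) (add_zero 1) := fun x => by
      have hq : dualMap F Aᵐᵒᵖ (dualMap F A (rmul A a)) ≫ q.inv =
          q.inv ≫ lmul Aᵐᵒᵖ (op a) := by
        rw [Iso.comp_inv_eq, Category.assoc, Iso.eq_inv_comp]
        exact (lmul_comp_evalHom a).symm
      rw [hX, he, he, Ext.comp_assoc_of_third_deg_zero, Ext.mk₀_comp_mk₀, hq,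
        Ext.comp_assoc_of_third_deg_zero (Ext.mk₀ p), Ext.comp_assoc_of_third_deg_zero (Φ x),
        Ext.mk₀_comp_mk₀]
    exact h

end ExtDuality

/-! ### The preprojective algebra as an opposite tensor algebra. -/

section UniversalProperty

variable (F : Type u) [Field F] (A : Type u) [Ring A] [Algebra F A]

instance T_finite [FiniteDimensional F A] (r : ℕ) : Module.Finite A (T F A r) := by
  induction r with
  | zero => exact inferInstanceAs (Module.Finite A A)
  | succ r ih => exact tauMinus_finite (T F A r)

variable {F A}

variable (F) in
/-- An element of `A`, as an element of `τ^0 A`. -/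
def scalar (a : A) : T F A 0 := a

/-- The element `x ⊗ y` of `τ^{-(r+1)} A = τ⁻A ⊗ τ^{-r} A`. -/
def tens {r : ℕ} (y : T F A r) (x : T F A 1) : T F A (r + 1) :=
  (tauMinus F A).map (elemMap y) x

theorem smul_tens {r : ℕ} (a : A) (y : T F A r) (x : T F A 1) :
    a • tens y x = tens y (a • x) :=
  (map_smul ((tauMinus F A).map (elemMap y)).hom a x).symm

theorem tens_scalar_one (x : T F A 1) : tens (scalar F (1 : A)) x = x := by
  have h : elemMap (scalar F (1 : A)) = 𝟙 (ModuleCat.of A A) := elemMap_one (𝟙 (ModuleCat.of A A))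
  have h' : (tauMinus F A).map (elemMap (scalar F (1 : A))) = 𝟙 _ := by
    rw [h]
    exact (tauMinus F A).map_id _
  exact congrArg (fun k => k x) h'

/-- The element `x` of `τ^{-r} A`, as a homogeneous element of the preprojective algebra. -/
def homog (r : ℕ) : T F A r →+ PreprojAlg F A :=
  (DirectSum.of (Piece F A) r).comp (AddMonoidHom.mk' elemMap elemMap_add)

theorem homog_apply (r : ℕ) (x : T F A r) : homog r x = inDeg F A r (elemMap x) := rfl

theorem inDeg_eq_homog (r : ℕ) (f : Piece F A r) : inDeg F A r f = homog r (f (1 : A)) := by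
  rw [homog_apply, elemMap_one]

theorem homog_injective (r : ℕ) : Function.Injective (homog (F := F) (A := A) r) := fun _ _ h =>
  elemMap_injective (DirectSum.of_injective r h)

theorem homog_mul_scalar (s : ℕ) (y : T F A s) (a : A) :
    homog s y * homog 0 (scalar F a) = homog s (a • y) := by
  rw [homog_apply, homog_apply, homog_apply, of_mul_of']
  refine congrArg (DirectSum.of (Piece F A) s) ?_
  change elemMap a ≫ elemMap y ≫ 𝟙 _ = _
  rw [Category.comp_id]
  exact (elemMap_smul a y).symm

/-- The left factor `y` becomes the second tensor factor in `x ⊗ y`; hence the opposite ring in the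
universal property below. -/
theorem homog_mul_homog_one (s : ℕ) (y : T F A s) (x : T F A 1) :
    homog s y * homog 1 x = homog (s + 1) (tens y x) := by
  rw [homog_apply, homog_apply, homog_apply, of_mul_of']
  refine congrArg (DirectSum.of (Piece F A) (s + 1)) ?_
  refine (congrArg (fun k => elemMap x ≫ k) (Category.comp_id ((tauMinus F A).map
    (elemMap y)))).trans ?_
  exact elemMap_comp (M := (tauMinus F A).obj (ModuleCat.of A A)) x
    ((tauMinus F A).map (elemMap y))

theorem homog_scalar_one : homog 0 (scalar F (1 : A)) = 1 := by
  rw [homog_apply]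
  exact congrArg (DirectSum.of (Piece F A) 0) (elemMap_one (𝟙 (ModuleCat.of A A)))

theorem homog_mul_homog (s r : ℕ) (y : T F A s) (x : T F A r) {n : ℕ} (h : s + r = n) :
    ∃ z : T F A n, homog s y * homog r x = homog n z := by
  subst h
  rw [homog_apply, homog_apply, of_mul_of', inDeg_eq_homog]
  exact ⟨_, rfl⟩

/-- The quotient map by `H` agrees with zero on pure tensors. -/
theorem RightExactOnFinite.eq_top_of_map_elemMap_mem [FiniteDimensional F A]
    (hτ : RightExactOnFinite (tauMinus F A)) {r : ℕ} (H : AddSubgroup (T F A (r + 1)))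
    (h : ∀ (y : T F A r) (x : T F A 1),
      tens y x ∈ H) : H = ⊤ := by
  have := isNoetherianRing_of_finiteDimensional F A
  have h0 : QuotientAddGroup.mk' H = 0 :=
    hτ.addHom_ext (M := T F A r) fun y x => (QuotientAddGroup.eq_zero_iff _).2 (h y x)
  rw [← QuotientAddGroup.ker_mk' H, h0]
  exact AddMonoidHom.ker_zero

theorem RightExactOnFinite.addHom_ext_succ [FiniteDimensional F A]
    (hτ : RightExactOnFinite (tauMinus F A)) {r : ℕ} {X : Type*} [AddCommGroup X]
    {γ γ' : T F A (r + 1) →+ X}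
    (h : ∀ (y : T F A r) (x : T F A 1),
      γ (tens y x) = γ' (tens y x)) : γ = γ' :=
  have := isNoetherianRing_of_finiteDimensional F A
  hτ.addHom_ext (M := T F A r) h

theorem addHom_ext_homog {X : Type*} [AddCommGroup X] {γ γ' : PreprojAlg F A →+ X}
    (h : ∀ r x, γ (homog r x) = γ' (homog r x)) : γ = γ' :=
  DirectSum.addHom_ext fun r f => by
    have := h r (f (1 : A))
    rwa [← inDeg_eq_homog] at this

/-- The preprojective algebra is generated in degrees `0` and `1`. -/
theorem RightExactOnFinite.ringHom_ext [FiniteDimensional F A]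
    (hτ : RightExactOnFinite (tauMinus F A)) {S : Type*} [Ring S] {ψ ψ' : PreprojAlg F A →+* S}
    (h₀ : ∀ a : A, ψ (homog 0 (scalar F a)) = ψ' (homog 0 (scalar F a)))
    (h₁ : ∀ x, ψ (homog 1 x) = ψ' (homog 1 x)) : ψ = ψ' := by
  have key : ∀ r, (ψ : PreprojAlg F A →+ S).comp (homog r) =
      (ψ' : PreprojAlg F A →+ S).comp (homog r) := fun r => by
    induction r with
    | zero => exact AddMonoidHom.ext h₀
    | succ r ih =>
      refine hτ.addHom_ext_succ fun y x => ?_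
      change ψ (homog (r + 1) (tens y x)) = ψ' (homog (r + 1) (tens y x))
      rw [← homog_mul_homog_one, map_mul, map_mul, h₁]
      exact congrArg (· * _) (DFunLike.congr_fun ih y)
  refine RingHom.ext fun z => ?_
  exact DFunLike.congr_fun (addHom_ext_homog (γ := (ψ : PreprojAlg F A →+ S))
    (γ' := (ψ' : PreprojAlg F A →+ S)) fun r x => DFunLike.congr_fun (key r) x) z

/-- Recursion on the degree: `(x, y) ↦ lam x * ψ r y` is balanced over `A`, by `hr` and the left
linearity of `ψ r`, so it factors through `τ⁻A ⊗ τ^{-r}A`. -/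
theorem RightExactOnFinite.exists_extend [FiniteDimensional F A]
    (hτ : RightExactOnFinite (tauMinus F A)) {S : Type*} [Ring S] (α : A →+* S)
    (lam : T F A 1 →+ S) (hl : ∀ (a : A) x, lam (a • x) = α a * lam x)
    (hr : ∀ (a : A) x, lam (rightAct F A 1 a x) = lam x * α a) :
    ∃ ψ : ∀ r, T F A r →+ S, (∀ a : A, ψ 0 (scalar F a) = α a) ∧
      (∀ r (y : T F A r) (x : T F A 1),
        ψ (r + 1) (tens y x) = lam x * ψ r y) ∧
      ∀ r (a : A) (y : T F A r), ψ r (a • y) = α a * ψ r y := by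
  have := isNoetherianRing_of_finiteDimensional F A
  -- Left linearity travels with the map, since it is what makes the next pairing balanced; `hl`
  -- restores it one degree up.
  let V : ℕ → Type _ := fun r =>
    {ψ : T F A r →+ S // ∀ (a : A) (y : T F A r), ψ (a • y) = α a * ψ y}
  have step : ∀ r (ψ : V r), ∃ ψ' : V (r + 1), ∀ (y : T F A r) (x : T F A 1),
      ψ'.1 (tens y x) = lam x * ψ.1 y := fun r ψ => by
    let β : T F A 1 →+ T F A r →+ S := (AddMonoidHom.mul.comp lam).compl₂ ψ.1
    have hβ : ∀ (x : T F A 1) (a : A) (m : T F A r),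
        β (rightAct F A 1 a x) m = β x (a • m) := fun x a m => by
      change lam (rightAct F A 1 a x) * ψ.1 m = lam x * ψ.1 (a • m)
      rw [hr, ψ.2, mul_assoc]
    obtain ⟨γ, hγ⟩ : ∃ γ : T F A (r + 1) →+ S, ∀ (y : T F A r) (x : T F A 1),
        γ (tens y x) = lam x * ψ.1 y := hτ.exists_lift (M := T F A r) β hβ
    refine ⟨⟨γ, fun a => ?_⟩, hγ⟩
    have h : γ.comp (DistribSMul.toAddMonoidHom (T F A (r + 1)) a) =
        (AddMonoidHom.mulLeft (α a)).comp γ := by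
      refine hτ.addHom_ext_succ fun y x => ?_
      change γ (a • tens y x) = α a * γ (tens y x)
      rw [smul_tens, hγ, hγ, hl, mul_assoc]
    exact DFunLike.congr_fun h
  choose next hnext using step
  let ψ : ∀ r, V r := fun r =>
    Nat.rec (motive := V) ⟨α.toAddMonoidHom, fun a y => α.map_mul a y⟩ next r
  exact ⟨fun r => (ψ r).1, fun _ => rfl, fun r => hnext r (ψ r), fun r => (ψ r).2⟩

/-- The preprojective algebra is the opposite of the tensor algebra of the bimodule `τ⁻A`. -/
theorem RightExactOnFinite.exists_ringHom [FiniteDimensional F A]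
    (hτ : RightExactOnFinite (tauMinus F A)) {S : Type*} [Ring S] (α : A →+* S)
    (lam : T F A 1 →+ S) (hl : ∀ (a : A) x, lam (a • x) = α a * lam x)
    (hr : ∀ (a : A) x, lam (rightAct F A 1 a x) = lam x * α a) :
    ∃ ψ : PreprojAlg F A →+* Sᵐᵒᵖ, (∀ a : A, ψ (homog 0 (scalar F a)) = op (α a)) ∧
      ∀ x, ψ (homog 1 x) = op (lam x) := by
  obtain ⟨ψ, h₀, hs, hsmul⟩ := hτ.exists_extend α lam hl hr
  let Ψ : PreprojAlg F A →+ S := DirectSum.toAddMonoid fun r =>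
    (ψ r).comp (AddMonoidHom.mk' (fun f : Piece F A r => f (1 : A)) fun _ _ => rfl)
  have hΨ : ∀ r x, Ψ (homog r x) = ψ r x := fun r x => by
    rw [homog_apply]
    refine (DirectSum.toAddMonoid_of _ _ _).trans ?_
    exact congrArg (ψ r) (elemMap_apply_one x)
  have h1 : ∀ x, ψ 1 x = lam x := fun x => by
    rw [← tens_scalar_one x, hs, h₀, map_one, mul_one, tens_scalar_one]
  have hmul₁ : ∀ (x : T F A 1) g, Ψ (g * homog 1 x) = lam x * Ψ g := fun x => by
    refine DFunLike.congr_fun (addHom_ext_homog (γ := Ψ.comp (AddMonoidHom.mulRight (homog 1 x)))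
      (γ' := (AddMonoidHom.mulLeft (lam x)).comp Ψ) fun s y => ?_)
    change Ψ (homog s y * homog 1 x) = lam x * Ψ (homog s y)
    rw [homog_mul_homog_one, hΨ, hΨ, hs]
  -- Induction on the degree of the right factor: degree 0 is left linearity, and a pure tensor is a
  -- product whose last factor has degree 1, handled by `hmul₁` and associativity.
  have hmul : ∀ r (x : T F A r) g, Ψ (g * homog r x) = ψ r x * Ψ g := fun r => by
    induction r with
    | zero =>
      have h : ∀ (a : A) g, Ψ (g * homog 0 (scalar F a)) = ψ 0 (scalar F a) * Ψ g := fun a => by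
        refine DFunLike.congr_fun (addHom_ext_homog
          (γ := Ψ.comp (AddMonoidHom.mulRight (homog 0 (scalar F a))))
          (γ' := (AddMonoidHom.mulLeft (ψ 0 (scalar F a))).comp Ψ) fun s y => ?_)
        change Ψ (homog s y * homog 0 (scalar F a)) = ψ 0 (scalar F a) * Ψ (homog s y)
        rw [homog_mul_scalar, hΨ, hΨ, hsmul, h₀]
      exact h
    | succ r ih =>
      intro x g
      refine DFunLike.congr_fun (hτ.addHom_ext_succ
        (γ := Ψ.comp ((AddMonoidHom.mulLeft g).comp (homog (r + 1))))
        (γ' := (AddMonoidHom.mulRight (Ψ g)).comp (ψ (r + 1))) fun y x => ?_) x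
      change Ψ (g * homog (r + 1) (tens y x)) =
        ψ (r + 1) (tens y x) * Ψ g
      rw [← homog_mul_homog_one, ← mul_assoc, hmul₁, ih, hs, mul_assoc]
  refine ⟨{ toFun := fun z => op (Ψ z), map_one' := ?_, map_mul' := fun g f => ?_,
            map_zero' := ?_, map_add' := fun _ _ => ?_ }, fun a => ?_, fun x => ?_⟩
  · rw [← homog_scalar_one, hΨ, h₀, map_one, op_one]
  · rw [← op_mul]
    refine congrArg op ?_
    refine DFunLike.congr_fun (addHom_ext_homog (γ := Ψ.comp (AddMonoidHom.mulLeft g))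
      (γ' := (AddMonoidHom.mulRight (Ψ g)).comp Ψ) fun r x => ?_) f
    change Ψ (g * homog r x) = Ψ (homog r x) * Ψ g
    rw [hmul, hΨ]
  · rw [map_zero, op_zero]
  · rw [map_add]
    rfl
  · exact congrArg op ((hΨ 0 _).trans (h₀ a))
  · exact congrArg op ((hΨ 1 x).trans (h1 x))

end UniversalProperty

/-! ### Degree-zero multiplication and the corners cut out by idempotents. -/

section Corners

variable {F : Type u} [Field F] {A : Type u} [Ring A] [Algebra F A]

/-- Together with `homog_mul_scalar`, this expresses both actions on `τ^{-r}A` as products with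
degree 0, so that bimodule compatibility and multiplicativity become interchangeable. -/
theorem scalar_mul_homog (r : ℕ) (a : A) (x : T F A r) :
    homog 0 (scalar F a) * homog r x = homog r (rightAct F A r a x) := by
  rw [homog_apply, homog_apply, homog_apply, of_mul_of']
  refine DirectSum.of_eq_of_gradedMonoid_eq (mk_eq_mk F A (zero_add r) _ _ ?_)
  have h : elemMap (rightAct F A r a x) = elemMap x ≫ (tauPow F A r).map (rmul A a) :=
    (elemMap_comp x _).symm
  rw [h, Category.assoc, Category.assoc, eqToHom_trans]
  exact congrArg (fun k => elemMap x ≫ k) (Category.comp_id _)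

theorem algebraMap_eq_homog (c : F) :
    algebraMap F (PreprojAlg F A) c = homog 0 (scalar F (algebraMap F A c)) := by
  rw [DirectSum.algebraMap_apply]
  refine congrArg (DirectSum.of (Piece F A) 0) ?_
  exact ModuleCat.hom_ext (LinearMap.ext fun a : A => Algebra.commutes c a)

theorem rightAct_smul (r : ℕ) (a b : A) (x : T F A r) :
    rightAct F A r a (b • x) = b • rightAct F A r a x :=
  map_smul ((tauPow F A r).map (rmul A a)).hom b x

theorem projRetr_comp_projIncl (e : A) : projRetr A e ≫ projIncl A e = rmul A e := rfl

theorem projIncl_comp_projRetr {e : A} (he : IsIdempotentElem e) :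
    projIncl A e ≫ projRetr A e = 𝟙 _ := by
  refine ModuleCat.hom_ext (LinearMap.ext fun x => Subtype.ext ?_)
  obtain ⟨a, ha⟩ := Submodule.mem_span_singleton.1 x.2
  change x.1 * e = x.1
  rw [← ha, smul_eq_mul, mul_assoc, he]

variable (F) in
theorem cornerIncl_injective (r : ℕ) {e e' : A} (he : IsIdempotentElem e)
    (he' : IsIdempotentElem e') : Function.Injective (cornerIncl F A r e e') := by
  refine Function.LeftInverse.injective
    (g := fun f => projIncl A e ≫ f ≫ (tauPow F A r).map (projRetr A e')) fun f => ?_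
  simp only [cornerIncl, Category.assoc]
  rw [← Functor.map_comp, projIncl_comp_projRetr he', reassoc_of% (projIncl_comp_projRetr he),
    CategoryTheory.Functor.map_id, Category.comp_id]

/-- The corner is a retract of `Hom(A, τ^{-r}A)`, hence the fixed set of the idempotent `x ↦ e x
e'`. In this form only the two actions matter. -/
theorem mem_range_cornerIncl (r : ℕ) {e e' : A} (he : IsIdempotentElem e)
    (he' : IsIdempotentElem e') (x : T F A r) :
    elemMap x ∈ Set.range (cornerIncl F A r e e') ↔ rightAct F A r e' (e • x) = x := by
  have h : elemMap (rightAct F A r e' (e • x)) =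
      rmul A e ≫ elemMap x ≫ (tauPow F A r).map (rmul A e') := by
    rw [← Category.assoc, ← elemMap_smul, elemMap_comp]
    rfl
  constructor
  · rintro ⟨f, hf⟩
    refine elemMap_injective ?_
    rw [h, ← hf, cornerIncl, ← projRetr_comp_projIncl e, ← projRetr_comp_projIncl e']
    simp only [Category.assoc]
    rw [← Functor.map_comp, reassoc_of% (projIncl_comp_projRetr he), ← Category.assoc (projIncl A e'),
      projIncl_comp_projRetr he', Category.id_comp]
  · intro hx
    refine ⟨projIncl A e ≫ elemMap x ≫ (tauPow F A r).map (projRetr A e'), ?_⟩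
    conv_rhs => rw [← hx, h]
    rw [cornerIncl, ← projRetr_comp_projIncl e, ← projRetr_comp_projIncl e',
      Functor.map_comp]
    simp only [Category.assoc]

variable (F) in
/-- The inclusion of `Hom(A e, τ^{-r}(A e'))` into the preprojective algebra. -/
def cornerLin (r : ℕ) (e e' : A) :
    (proj A e ⟶ (tauPow F A r).obj (proj A e')) →ₗ[F] PreprojAlg F A :=
  let J : (proj A e ⟶ (tauPow F A r).obj (proj A e')) →ₗ[F] Piece F A r :=
    { toFun := cornerIncl F A r e e'
      map_add' := fun f g => by simp [cornerIncl]
      map_smul' := fun c f => by simp [cornerIncl] }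
  (DirectSum.lof F ℕ (Piece F A) r).comp J

theorem cornerLin_injective (r : ℕ) {e e' : A} (he : IsIdempotentElem e)
    (he' : IsIdempotentElem e') : Function.Injective (cornerLin F r e e') := fun _ _ h =>
  cornerIncl_injective F r he he' (DirectSum.of_injective r h)

theorem exists_linearEquiv_of_map_range_eq {X Y P Q : Type*} [AddCommGroup X] [AddCommGroup Y]
    [AddCommGroup P] [AddCommGroup Q] [Module F X] [Module F Y] [Module F P] [Module F Q]
    {J : X →ₗ[F] P} {K : Y →ₗ[F] Q} (hJ : Function.Injective J) (hK : Function.Injective K)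
    (R : P ≃ₗ[F] Q) (h : (LinearMap.range J).map (R : P →ₗ[F] Q) = LinearMap.range K) :
    ∃ φ : X ≃ₗ[F] Y, ∀ x, R (J x) = K (φ x) := by
  refine ⟨(LinearEquiv.ofInjective J hJ).trans ((R.submoduleMap _).trans
    ((LinearEquiv.ofEq _ _ h).trans (LinearEquiv.ofInjective K hK).symm)), fun x => ?_⟩
  have h' := congrArg Subtype.val ((LinearEquiv.ofInjective K hK).apply_symm_apply
    ((LinearEquiv.ofEq _ _ h) ((R.submoduleMap _) (LinearEquiv.ofInjective J hJ x))))
  exact h'.symm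

end Corners

/-! ### The anti-isomorphism attached to `θ₁`. -/

section AntiIsomorphism

variable {F : Type u} [Field F] {Λ : Type u} [Ring Λ] [Algebra F Λ]

theorem BimoduleIso.toAddEquiv_injective {r : ℕ} {θ θ' : BimoduleIso F Λ r}
    (h : ∀ x, θ.toAddEquiv x = θ'.toAddEquiv x) : θ = θ' := by
  obtain ⟨e, _, _⟩ := θ
  obtain ⟨e', _, _⟩ := θ'
  obtain rfl : e = e' := AddEquiv.ext h
  rfl

variable (F Λ) in
/-- The degree zero part of the right preprojective algebra. -/
def scalarOp : Λ →+* PreprojAlg F Λᵐᵒᵖ where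
  toFun a := homog 0 (scalar F (op a))
  map_one' := homog_scalar_one
  map_mul' a b := (homog_mul_scalar 0 (scalar F (op a)) (op b)).symm
  map_zero' := map_zero (homog 0)
  map_add' a b := map_add (homog 0) (scalar F (op a)) (scalar F (op b))

variable (F Λ) in
/-- The degree zero part of the left preprojective algebra. -/
def scalarUnop : Λᵐᵒᵖ →+* PreprojAlg F Λ where
  toFun a := homog 0 (scalar F (unop a))
  map_one' := homog_scalar_one
  map_mul' a b := (homog_mul_scalar 0 (scalar F (unop a)) (unop b)).symm
  map_zero' := map_zero (homog 0)
  map_add' a b := map_add (homog 0) (scalar F (unop a)) (scalar F (unop b))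

/-- Mutual inverseness of anti-homomorphisms is phrased as equality of ring homomorphisms into
double opposites, so that it can be tested in degrees 0 and 1 by `RightExactOnFinite.ringHom_ext`.
-/
theorem bijective_of_comp_eq {P Q : Type*} [Ring P] [Ring Q] (ψ : P →+* Qᵐᵒᵖ) (φ : Q →+* Pᵐᵒᵖ)
    (h : (RingHom.op φ).comp ψ = (RingEquiv.opOp P : P →+* Pᵐᵒᵖᵐᵒᵖ))
    (h' : (RingHom.op ψ).comp φ = (RingEquiv.opOp Q : Q →+* Qᵐᵒᵖᵐᵒᵖ)) :
    (∀ p, unop (φ (unop (ψ p))) = p) ∧ ∀ q, unop (ψ (unop (φ q))) = q :=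
  ⟨fun p => congrArg (fun z => unop (unop z)) (DFunLike.congr_fun h p),
    fun q => congrArg (fun z => unop (unop z)) (DFunLike.congr_fun h' q)⟩

/-- A ring homomorphism into the opposite algebra that respects degrees `0` and `1` is graded. -/
theorem RightExactOnFinite.exists_homog_eq {A B : Type u} [Ring A] [Algebra F A] [Ring B]
    [Algebra F B] [FiniteDimensional F A] (hτ : RightExactOnFinite (tauMinus F A))
    (ψ : PreprojAlg F A →+* (PreprojAlg F B)ᵐᵒᵖ)
    (h₀ : ∀ a : A, ∃ z, ψ (homog 0 (scalar F a)) = op (homog 0 z))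
    (h₁ : ∀ x, ∃ z, ψ (homog 1 x) = op (homog 1 z)) (r : ℕ) :
    ∀ x, ∃ z, ψ (homog r x) = op (homog r z) := by
  induction r with
  | zero => exact h₀
  | succ r ih =>
    -- `H` consists of the `x` whose image is homogeneous of degree `r + 1`. It contains the pure
    -- tensors, whose images are products of degrees 1 and `r`, in that order because `ψ` reverses
    -- products.
    let H : AddSubgroup (T F A (r + 1)) :=
      (homog (F := F) (A := B) (r + 1)).range.comap
        ((opAddEquiv (α := PreprojAlg F B)).symm.toAddMonoidHom.comp
          ((ψ : PreprojAlg F A →+ (PreprojAlg F B)ᵐᵒᵖ).comp (homog (r + 1))))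
    have hH : H = ⊤ := hτ.eq_top_of_map_elemMap_mem H fun y x => by
      obtain ⟨z, hz⟩ := ih y
      obtain ⟨w, hw⟩ := h₁ x
      obtain ⟨v, hv⟩ := homog_mul_homog 1 r w z (Nat.add_comm 1 r)
      refine ⟨v, ?_⟩
      change homog (r + 1) v = unop (ψ (homog (r + 1) (tens y x)))
      rw [← homog_mul_homog_one, map_mul, hz, hw, ← op_mul, hv, unop_op]
    intro x
    have hx : x ∈ H := hH ▸ AddSubgroup.mem_top x
    obtain ⟨z, hz⟩ := hx
    exact ⟨z, congrArg op hz.symm⟩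

/-- The universal property on each side turns `θ₁` and its inverse into anti-homomorphisms `ψ` and
`φ`. Their composites fix degrees 0 and 1, so they are inverse to each other. -/
theorem exists_antiIso [FiniteDimensional F Λ] (hl : RightExactOnFinite (tauMinus F Λ))
    (hr : RightExactOnFinite (tauMinus F Λᵐᵒᵖ)) (θ₁ : BimoduleIso F Λ 1) :
    ∃ (R : PreprojAlg F Λ ≃ₐ[F] (PreprojAlg F Λᵐᵒᵖ)ᵐᵒᵖ) (θ : ∀ r, BimoduleIso F Λ r),
      (∀ a : Λ, (θ 0).toAddEquiv a = op a) ∧ θ 1 = θ₁ ∧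
      ∀ r x, R (homog r x) = op (homog r ((θ r).toAddEquiv x)) := by
  obtain ⟨ψ, hψ₀, hψ₁⟩ := hl.exists_ringHom (scalarOp F Λ)
    ((homog 1).comp θ₁.toAddEquiv.toAddMonoidHom)
    (fun a x => by
      refine (congrArg (homog 1) (θ₁.map_left a x)).trans ?_
      exact (scalar_mul_homog 1 (op a) (θ₁.toAddEquiv x)).symm)
    (fun a x => by
      refine (congrArg (homog 1) (θ₁.map_right a x)).trans ?_
      exact (homog_mul_scalar 1 (θ₁.toAddEquiv x) (op a)).symm)
  obtain ⟨φ, hφ₀, hφ₁⟩ := hr.exists_ringHom (scalarUnop F Λ)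
    ((homog 1).comp θ₁.toAddEquiv.symm.toAddMonoidHom)
    (fun a z => by
      have h : θ₁.toAddEquiv.symm (a • z) =
          rightAct F Λ 1 (unop a) (θ₁.toAddEquiv.symm z) := by
        rw [AddEquiv.symm_apply_eq]
        refine Eq.trans ?_ (θ₁.map_right (unop a) _).symm
        exact congrArg (a • ·) (θ₁.toAddEquiv.apply_symm_apply z).symm
      refine (congrArg (homog 1) h).trans ?_
      exact (scalar_mul_homog 1 (unop a) (θ₁.toAddEquiv.symm z)).symm)
    (fun a z => by
      have h : θ₁.toAddEquiv.symm (rightAct F Λᵐᵒᵖ 1 a z) =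
          unop a • θ₁.toAddEquiv.symm z := by
        rw [AddEquiv.symm_apply_eq]
        refine Eq.trans ?_ (θ₁.map_left (unop a) _).symm
        exact congrArg (rightAct F Λᵐᵒᵖ 1 a) (θ₁.toAddEquiv.apply_symm_apply z).symm
      refine (congrArg (homog 1) h).trans ?_
      exact (homog_mul_scalar 1 (θ₁.toAddEquiv.symm z) (unop a)).symm)
  obtain ⟨hφψ, hψφ⟩ := bijective_of_comp_eq ψ φ
    (hl.ringHom_ext
      (fun a => by
        change op (φ (unop (ψ (homog 0 (scalar F a))))) = op (op (homog 0 (scalar F a)))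
        rw [hψ₀]
        exact congrArg op (hφ₀ (op a)))
      (fun x => by
        change op (φ (unop (ψ (homog 1 x)))) = op (op (homog 1 x))
        rw [hψ₁]
        refine congrArg op ((hφ₁ (θ₁.toAddEquiv x)).trans ?_)
        exact congrArg (fun y => op (homog 1 y)) (θ₁.toAddEquiv.symm_apply_apply x)))
    (hr.ringHom_ext
      (fun a => by
        change op (ψ (unop (φ (homog 0 (scalar F a))))) = op (op (homog 0 (scalar F a)))
        rw [hφ₀]
        exact congrArg op (hψ₀ (unop a)))
      (fun z => by
        change op (ψ (unop (φ (homog 1 z)))) = op (op (homog 1 z))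
        rw [hφ₁]
        refine congrArg op ((hψ₁ (θ₁.toAddEquiv.symm z)).trans ?_)
        exact congrArg (fun y => op (homog 1 y)) (θ₁.toAddEquiv.apply_symm_apply z)))
  have hψg := fun r => hl.exists_homog_eq ψ (fun a => ⟨_, hψ₀ a⟩) (fun x => ⟨_, hψ₁ x⟩) r
  have hφg := fun r => hr.exists_homog_eq φ (fun a => ⟨_, hφ₀ a⟩) (fun x => ⟨_, hφ₁ x⟩) r
  choose t ht using hψg
  choose t' ht' using hφg
  let R : PreprojAlg F Λ ≃ₐ[F] (PreprojAlg F Λᵐᵒᵖ)ᵐᵒᵖ :=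
    AlgEquiv.ofRingEquiv (f := { ψ with
        invFun := fun q => unop (φ (unop q))
        left_inv := hφψ
        right_inv := fun q => congrArg op (hψφ (unop q)) })
      fun c => by
        change ψ (algebraMap F (PreprojAlg F Λ) c) = op (algebraMap F (PreprojAlg F Λᵐᵒᵖ) c)
        rw [algebraMap_eq_homog, algebraMap_eq_homog, hψ₀]
        rfl
  have homog_op_inj : ∀ {r} {x y : T F Λᵐᵒᵖ r}, op (homog r x) = op (homog r y) → x = y :=
    fun h => homog_injective _ (op_injective h)
  -- The degree `r` component of `ψ`, with inverse that of `φ`. The two actions are products with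
  -- degree-zero elements on opposite sides, and `ψ` interchanges the sides.
  let θ : ∀ r, BimoduleIso F Λ r := fun r =>
    { toFun := t r
      invFun := t' r
      left_inv := fun x => homog_injective r (by
        have h := hφψ (homog r x)
        rw [ht, unop_op, ht', unop_op] at h
        exact h)
      right_inv := fun z => homog_injective r (by
        have h := hψφ (homog r z)
        rw [ht', unop_op, ht, unop_op] at h
        exact h)
      map_add' := fun x y => homog_op_inj (by
        rw [← ht, map_add, map_add, ht, ht, map_add, MulOpposite.op_add])
      map_left := fun a x => homog_op_inj (by
        rw [← ht, ← homog_mul_scalar, map_mul, hψ₀, ht, ← op_mul, ← scalar_mul_homog]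
        rfl)
      map_right := fun a x => homog_op_inj (by
        rw [← ht, ← scalar_mul_homog, map_mul, hψ₀, ht, ← op_mul, ← homog_mul_scalar]
        rfl) }
  refine ⟨R, θ, fun a => ?_, ?_, fun r x => ht r x⟩
  · exact homog_op_inj ((ht 0 (scalar F a)).symm.trans (hψ₀ a))
  · exact BimoduleIso.toAddEquiv_injective fun x =>
      homog_op_inj ((ht 1 x).symm.trans (hψ₁ x))

/-- `θ` intertwines `x ↦ e x e'` on both sides, hence matches their fixed sets. Over `Λᵐᵒᵖ` the
module action belongs to `e'` and the functorial one to `e`, so the idempotents trade places. -/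
theorem exists_corner_equiv {R : PreprojAlg F Λ ≃ₐ[F] (PreprojAlg F Λᵐᵒᵖ)ᵐᵒᵖ} {r : ℕ}
    (θ : BimoduleIso F Λ r) (hR : ∀ x, R (homog r x) = op (homog r (θ.toAddEquiv x)))
    {e e' : Λ} (he : IsIdempotentElem e) (he' : IsIdempotentElem e') :
    ∃ φ : (proj Λ e ⟶ (tauPow F Λ r).obj (proj Λ e')) ≃ₗ[F]
        (proj Λᵐᵒᵖ (op e') ⟶ (tauPow F Λᵐᵒᵖ r).obj (proj Λᵐᵒᵖ (op e))),
      ∀ f, R (inDeg F Λ r (cornerIncl F Λ r e e' f)) =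
        op (inDeg F Λᵐᵒᵖ r (cornerIncl F Λᵐᵒᵖ r (op e') (op e) (φ f))) := by
  have heo : IsIdempotentElem (op e) := congrArg op he
  have heo' : IsIdempotentElem (op e') := congrArg op he'
  have hθ : ∀ x, θ.toAddEquiv (rightAct F Λ r e' (e • x)) =
      rightAct F Λᵐᵒᵖ r (op e) (op e' • θ.toAddEquiv x) := fun x => by
    refine (θ.map_right e' (e • x)).trans ?_
    rw [rightAct_smul]
    exact congrArg (op e' • ·) (θ.map_left e x)
  have hmem : ∀ x, elemMap x ∈ Set.range (cornerIncl F Λ r e e') ↔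
      elemMap (θ.toAddEquiv x) ∈ Set.range (cornerIncl F Λᵐᵒᵖ r (op e') (op e)) := fun x => by
    rw [mem_range_cornerIncl r he he', mem_range_cornerIncl r heo' heo, ← hθ,
      θ.toAddEquiv.injective.eq_iff]
  refine exists_linearEquiv_of_map_range_eq (J := cornerLin F r e e')
    (K := (opLinearEquiv F (M := PreprojAlg F Λᵐᵒᵖ)).toLinearMap.comp (cornerLin F r (op e') (op e)))
    (cornerLin_injective r he he')
    (fun _ _ h => cornerLin_injective r heo' heo (op_injective h)) R.toLinearEquiv ?_
  ext q
  constructor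
  · rintro ⟨_, ⟨f, rfl⟩, rfl⟩
    obtain ⟨g, hg⟩ := (hmem (cornerIncl F Λ r e e' f (1 : Λ))).1 ⟨f, (elemMap_one _).symm⟩
    refine ⟨g, ?_⟩
    change op (inDeg F Λᵐᵒᵖ r (cornerIncl F Λᵐᵒᵖ r (op e') (op e) g)) =
      R (inDeg F Λ r (cornerIncl F Λ r e e' f))
    rw [hg, inDeg_eq_homog r (cornerIncl F Λ r e e' f), hR]
    rfl
  · rintro ⟨g, rfl⟩
    obtain ⟨x, hx⟩ := θ.toAddEquiv.surjective
      (cornerIncl F Λᵐᵒᵖ r (op e') (op e) g (1 : Λᵐᵒᵖ))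
    obtain ⟨f, hf⟩ := (hmem x).2 ⟨g, by rw [hx]; exact (elemMap_one _).symm⟩
    refine ⟨_, ⟨f, rfl⟩, ?_⟩
    change R (inDeg F Λ r (cornerIncl F Λ r e e' f)) =
      op (inDeg F Λᵐᵒᵖ r (cornerIncl F Λᵐᵒᵖ r (op e') (op e) g))
    rw [hf, inDeg_eq_homog r (cornerIncl F Λᵐᵒᵖ r (op e') (op e) g), ← hx, ← hR]
    rfl

end AntiIsomorphism

end

end Preproj

theorem corollary3p4 (F : Type u) [Field F] (Λ : Type u) [Ring Λ] [Algebra F Λ]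
    [FiniteDimensional F Λ] (hΛ : IsHereditary Λ) :
    Nonempty (Preproj.BimoduleIso F Λ 1) ∧
    ∀ θ₁ : Preproj.BimoduleIso F Λ 1,
      ∃! θ : ∀ r : ℕ, Preproj.BimoduleIso F Λ r,
        (∀ a : Λ, (θ 0).toAddEquiv a = op a) ∧ θ 1 = θ₁ ∧
        ∃ R : Preproj.PreprojAlg F Λ ≃ₐ[F] (Preproj.PreprojAlg F Λᵐᵒᵖ)ᵐᵒᵖ,
          (∀ (r : ℕ) (f : Preproj.Piece F Λ r),
            R (Preproj.inDeg F Λ r f) =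
              op (Preproj.inDeg F Λᵐᵒᵖ r
                (Preproj.mulMap F Λᵐᵒᵖ r ((θ r).toAddEquiv (f (1 : Λ)))))) ∧
          ∀ (r : ℕ) (e e' : Λ), IsIdempotentElem e → IsIdempotentElem e' →
            ∃ φ : (Preproj.proj Λ e ⟶ (Preproj.tauPow F Λ r).obj (Preproj.proj Λ e')) ≃ₗ[F]
                (Preproj.proj Λᵐᵒᵖ (op e') ⟶
                  (Preproj.tauPow F Λᵐᵒᵖ r).obj (Preproj.proj Λᵐᵒᵖ (op e))),
              ∀ f, R (Preproj.inDeg F Λ r (Preproj.cornerIncl F Λ r e e' f)) =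
                op (Preproj.inDeg F Λᵐᵒᵖ r
                  (Preproj.cornerIncl F Λᵐᵒᵖ r (op e') (op e) (φ f))) := by
  refine ⟨Preproj.nonempty_bimoduleIso_one, fun θ₁ => ?_⟩
  have hopop := (Preproj.freeSubmodulesProjective_of_isHereditary hΛ).opop
  have hl : Preproj.RightExactOnFinite (Preproj.tauMinus F Λ) :=
    Preproj.tauMinus_rightExactOnFinite (Preproj.FreeSubmodulesProjective.of_op (F := F) hopop)
  have hr : Preproj.RightExactOnFinite (Preproj.tauMinus F Λᵐᵒᵖ) :=
    Preproj.tauMinus_rightExactOnFinite hopop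
  obtain ⟨R, θ, hθ₀, hθ₁, hR⟩ := Preproj.exists_antiIso hl hr θ₁
  refine ⟨θ, ⟨hθ₀, hθ₁, R, fun r f => ?_, fun r e e' he he' =>
    Preproj.exists_corner_equiv (θ r) (hR r) he he'⟩, ?_⟩
  · rw [Preproj.inDeg_eq_homog, hR]
    rfl
  -- Uniqueness: `R'` and `R` agree in degrees 0 and 1, hence everywhere, and `θ r` can be read off
  -- from `R` in degree `r`. The corner condition plays no role.
  · rintro θ' ⟨hθ₀', hθ₁', R', hR', -⟩
    have hR'' : ∀ r x, R' (Preproj.homog r x) =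
        op (Preproj.homog r ((θ' r).toAddEquiv x)) := fun r x => by
      refine (hR' r (Preproj.elemMap x)).trans ?_
      rw [Preproj.elemMap_apply_one]
      rfl
    have hRR : R'.toAlgHom.toRingHom = R.toAlgHom.toRingHom := by
      refine hl.ringHom_ext (fun a => ?_) fun x => ?_
      · refine (hR'' 0 _).trans (Eq.trans ?_ (hR 0 _).symm)
        exact congrArg (fun z => op (Preproj.homog 0 z)) ((hθ₀' a).trans (hθ₀ a).symm)
      · refine (hR'' 1 _).trans (Eq.trans ?_ (hR 1 _).symm)
        rw [hθ₁, hθ₁']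
    funext r
    refine Preproj.BimoduleIso.toAddEquiv_injective fun x => ?_
    refine Preproj.homog_injective r (op_injective ?_)
    rw [← hR'', ← hR]
    exact DFunLike.congr_fun hRR _
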